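/- **Setting.** An example is a pair $(p,y)\in[0,1]\times\{0,1\}$. A loss $\ell:[0,1]\times\{0,1\}\to\mathbb R$ is *proper* if $\ell(p,q)\ge \ell(q,q)$ for all $p,q\in[0,1]$, where $\ell(p,q)=\mathbb E_{y\sim\mathrm{Ber}(q)}[\ell(p,y)]$. Let $\mathcal L^*$ be the class of proper losses with $|\ell(p,1)-\ell(p,0)|\le 1$ for all $p$, and let $\mathcal L^*_{\mu\text{-sc}}\subseteq\mathcal L^*$ be the class of *$\mu$-strongly proper* losses, those for which $\varphi(p)=\ell(p,p)$ satisfies $\varphi(\lambda x+(1-\lambda)y)\ge\lambda\varphi(x)+(1-\lambda)\varphi(y)+\lambda(1-\lambda)\frac{\mu}{2}(x-y)^2$ for all $x,y,\lambda\in[0,1]$. Write $[t]_0^1$ for the projection of $t\in\mathbb R$ onto $[0,1]$. A set $\mathcal K$ of functions $[0,1]\to[0,1]$ is a *valid post-processing class* if it contains the identity and, with each $\kappa$ and for all $s,t\in\mathbb R$, the function $p\mapsto[\kappa([p+s]_0^1)+t]_0^1$. Let $\mathsf{thr}(\mathcal K)=\{p\mapsto \mathrm{sign}_+(\kappa(p)-\tfrac12):\kappa\in\mathcal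 K\}$, where $\mathrm{sign}_+(t)=1$ for $t\ge0$ and $-1$ for $t<0$, and let $\mathsf{VCdim}(\mathsf{thr}(\mathcal K))\in\mathbb N\cup\{\infty\}$ be the largest size of a set shattered by it. For a distribution $J$ on $[0,1]\times\{0,1\}$ put $$\mathsf{CDL}_{\mathcal L,\mathcal K}(J)=\sup_{\ell\in\mathcal L,\,\kappa\in\mathcal K}\mathbb E_{(p,y)\sim J}[\ell(p,y)-\ell(\kappa(p),y)],\qquad \mathsf{ECE}(J)=\mathbb E_J\bigl|\mathbb E_J[y-p\mid p]\bigr|.$$ An *algorithm with $m$ samples* receives $m$ i.i.d. examples from an unknown Borel distribution $J$ and outputs, possibly at random, Accept or Reject. It is an $(\alpha,\beta)$-*tester* for $\mathsf{CDL}_{\mathcal L,\mathcal K}$ if for every $J$ it rejects with probability at least $2/3$ whenever $\mathsf{CDL}_{\mathcal L,\mathcal K}(J)>\alpha$, and accepts with probability at least $2/3$ whenever $\mathsf{CDL}_{\mathcal L,\mathcal K}(J)\le\beta$. It is an $(\alpha,\beta)$-*auditor* if the second requirement is imposed only when $\mathsf{ECE}(J)\le\beta/2$ (instead of when $\mathsf{CDL}_{\mathcal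 L,\mathcal K}(J)\le\beta$). Probabilities are over the samples and the internal randomness (for a non-measurable algorithm, lower integrals over the samples). Here $J$ ranges over the distributions for which $\mathcal K$ is a measurable class: with $J_1$ the law of $p$, every $\kappa\in\mathcal K$ is $J_1$-measurable, and for all $n$ and $\sigma\in\{\pm1\}^n$ the set $\{x\in[0,1]^n:\exists f\in\mathsf{thr}(\mathcal K)\ \forall i\ f(x_i)=\sigma_i\}$ is measurable for the completion of $J_1^{n}$. (If $J$ has countable support, this holds for every $\mathcal K$.) **Statement.** There are universal constants $C,c>0$ such that, for every valid post-processing class $\mathcal K$ with $d=\mathsf{VCdim}(\mathsf{thr}(\mathcal K))$: 1. If $d<\infty$, then for all $\alpha,\varepsilon,\mu\in(0,1)$ there is an $(\alpha,\alpha-\varepsilon)$-tester for $\mathsf{CDL}_{\mathcal L^*_{\mu\text{-sc}},\mathcal K}$ that uses at most $C\,d\log(2/\varepsilon)/\varepsilon^2$ samples. 2. For every $\mu\in(0,1/16)$, every $(1/8-2\mu,0)$-auditor for $\mathsf{CDL}_{\mathcal L^*_{\mu\text{-sc}},\mathcal K}$ uses at least $c\sqrt d$ samples; in particular, if $d=\infty$,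 no auditor with finitely many samples exists. -/

import Mathlib

open MeasureTheory

noncomputable section

namespace Calibration

/-! ### Losses -/

/-- The real value `0` or `1` of a binary outcome. -/
def outcomeVal (y : Bool) : ℝ := if y then 1 else 0

/-- A loss `ℓ : [0,1] × {0,1} → ℝ`. -/
abbrev Loss : Type := unitInterval → Bool → ℝ

/-- `ℓ(p, q) = E_{y ∼ Ber(q)} ℓ(p, y)`. -/
def Loss.expected (l : Loss) (p q : unitInterval) : ℝ :=
  (q : ℝ) * l p true + (1 - (q : ℝ)) * l p false

/-- A loss is proper if predicting the true bias is optimal. -/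
def Loss.IsProper (l : Loss) : Prop :=
  ∀ p q : unitInterval, 0 ≤ l.expected p q - l.expected q q

/-- The class `𝓛*` of proper losses with `|ℓ(p,1) - ℓ(p,0)| ≤ 1`. -/
def properLosses : Set Loss :=
  {l | l.IsProper ∧ ∀ p, |l p true - l p false| ≤ 1}

/-- The function `φ(p) = ℓ(p, p)` attached to a loss. -/
def Loss.bayes (l : Loss) (p : unitInterval) : ℝ := l.expected p p

/-- The class `𝓛*_{μ-sc}` of `μ`-strongly proper losses: the losses in `𝓛*` for which
`φ(p) = ℓ(p, p)` is `μ`-strongly concave on `[0,1]`. (`StrongConcaveOn` is about functions on `ℝ`,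
hence the extension of `φ`, whose values off `[0,1]` play no role.) -/
def stronglyProperLosses (μ : ℝ) : Set Loss :=
  {l | l ∈ properLosses ∧
    StrongConcaveOn (Set.Icc (0 : ℝ) 1) μ (Set.IccExtend (zero_le_one' ℝ) l.bayes)}

/-! ### Post-processings, thresholds and VC dimension -/

/-- The projection `[t]_0^1` of a real number onto `[0,1]`. -/
def clip (t : ℝ) : unitInterval := Set.projIcc 0 1 zero_le_one t

/-- A valid post-processing class: it contains the identity and is translation invariant. -/
structure IsValid (K : Set (unitInterval → unitInterval)) : Prop where
  id_mem : (fun p : unitInterval => p) ∈ K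
  translate_mem : ∀ κ ∈ K, ∀ s t : ℝ,
    (fun p : unitInterval => clip ((κ (clip ((p : ℝ) + s)) : ℝ) + t)) ∈ K

/-- `sign_+(t)`, equal to `1` for `t ≥ 0` and to `-1` for `t < 0`, with values in `{1, -1} = ℤˣ`. -/
def signPlus (t : ℝ) : ℤˣ := if 0 ≤ t then 1 else -1

/-- The upper thresholds `thr(K) = {p ↦ sign_+(κ(p) - 1/2) | κ ∈ K}`. -/
def thr (K : Set (unitInterval → unitInterval)) : Set (unitInterval → ℤˣ) :=
  {f | ∃ κ ∈ K, f = fun p => signPlus ((κ p : ℝ) - 1 / 2)}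

/-- `C` shatters `S` if every `{±1}`-valued function on `S` is the restriction of a member of `C`. -/
def Shatters (C : Set (unitInterval → ℤˣ)) (S : Set unitInterval) : Prop :=
  ∀ g : S → ℤˣ, ∃ f ∈ C, ∀ p : S, f p = g p

/-- The VC dimension: the largest size of a shattered set (`⊤` if unbounded). -/
def vcDim (C : Set (unitInterval → ℤˣ)) : ℕ∞ :=
  ⨆ S : {S : Set unitInterval // Shatters C S}, S.1.encard

/-! ### Calibration decision loss and expected calibration error -/

/-- An example `(p, y)`: a prediction and a binary outcome. -/
abbrev Example : Type := unitInterval × Bool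

/-- The calibration decision loss `CDL_{L,K}(J) = sup_{ℓ ∈ L, κ ∈ K} E_J[ℓ(p,y) - ℓ(κ(p),y)]`. -/
def cdl (L : Set Loss) (K : Set (unitInterval → unitInterval)) (J : Measure Example) : ℝ :=
  sSup {r | ∃ l ∈ L, ∃ κ ∈ K, r = ∫ z, (l z.1 z.2 - l (κ z.1) z.2) ∂J}

/-- The expected calibration error `ECE(J) = E_J |E[y - p | p]|`. -/
def ece (J : Measure Example) : ℝ :=
  ∫ z, |(J[fun w : Example => outcomeVal w.2 - (w.1 : ℝ) |
    MeasurableSpace.comap (Prod.fst : Example → unitInterval) inferInstance]) z| ∂J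

/-- `K` is a measurable class for the distribution `J`: with `J₁` the law of the prediction, each
`κ ∈ K` is `J₁`-measurable (so that the expectations in the CDL make sense), and for all `n` and all
labellings `σ`, the set of points `x ∈ [0,1]^n` that some threshold in `thr(K)` labels by `σ` is
measurable for the completion of `J₁ⁿ` (the usual condition of empirical process theory on an
uncountable class). This imposes nothing on `K` when `J` has countable support. -/
structure IsMeasurableClass (K : Set (unitInterval → unitInterval)) (J : Measure Example) :
    Prop where
  aemeasurable : ∀ κ ∈ K, AEMeasurable κ J.fst
  nullMeasurableSet : ∀ (n : ℕ) (σ : Fin n → ℤˣ),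
    NullMeasurableSet {x : Fin n → unitInterval | ∃ f ∈ thr K, ∀ i, f (x i) = σ i}
      (Measure.pi fun _ => J.fst)

/-! ### Testers and auditors -/

/-- The possible outputs of a tester or an auditor. -/
inductive Verdict : Type
  | accept
  | reject

/-- A randomized algorithm that uses `m` examples and returns a verdict: for each sample, the
distribution of its verdict over the internal randomness. -/
abbrev Algorithm (m : ℕ) : Type := (Fin m → Example) → PMF Verdict

/-- The probability that the algorithm outputs the verdict `v` on `m` independent examples from `J`,
over the sample and the internal randomness. (For a non-measurable algorithm this is the lower
integral, so that a lower bound on it is the stronger of the possible requirements.) -/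
def Algorithm.prob {m : ℕ} (A : Algorithm m) (J : Measure Example) (v : Verdict) : ENNReal :=
  ∫⁻ S, A S v ∂(Measure.pi fun _ : Fin m => J)

/-- `A` is an `(α, β)`-tester for `CDL_{L,K}`. -/
def IsTester (L : Set Loss) (K : Set (unitInterval → unitInterval)) (α β : ℝ) {m : ℕ}
    (A : Algorithm m) : Prop :=
  ∀ J : Measure Example, IsProbabilityMeasure J → IsMeasurableClass K J →
    (α < cdl L K J → 2 / 3 ≤ A.prob J Verdict.reject) ∧
    (cdl L K J ≤ β → 2 / 3 ≤ A.prob J Verdict.accept)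

/-- `A` is an `(α, β)`-auditor for `CDL_{L,K}`. -/
def IsAuditor (L : Set Loss) (K : Set (unitInterval → unitInterval)) (α β : ℝ) {m : ℕ}
    (A : Algorithm m) : Prop :=
  ∀ J : Measure Example, IsProbabilityMeasure J → IsMeasurableClass K J →
    (α < cdl L K J → 2 / 3 ≤ A.prob J Verdict.reject) ∧
    (ece J ≤ β / 2 → 2 / 3 ≤ A.prob J Verdict.accept)

end Calibration

end

open Calibration

open Filter Topology

namespace Calibration

/-! ### Proper losses -/

/-! Upper bound. For a proper loss, `l p false` increases and `l p true` decreases in `p`, and the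
bound on their difference confines each to a range of length 2. So `l p y - l (κ p) y` is a signed
sum of four monotone functions of `p` or `κ p`, each restricted to one label. By the layer-cake
formula, the expectation of such a function is an integral of probabilities of events "`κ p` lies in
an upper set and `y = b`". Validity of `K` turns these upper sets, up to a limit, into members of
`thr K`. Hence if two distributions agree up to `Δ` on all events `f p = 1 ∧ y = b` with `f ∈ thr
K`, their decision losses differ by at most `8 * Δ`, simultaneously for all losses
(`cdl_le_cdl_add`). The VC theorem (`exists_measurable_uniform`: ghost sample, random swaps,
Hoeffding, Sauer-Shelah) gives this agreement between `J` and the empirical distribution, so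
comparing the empirical decision loss with a threshold is a tester.

Lower bound. Translating inputs by `±1/4` moves at least half of a shattered set into `[1/4, 3/4]`,
giving `n` shattered points `x`. Let the prediction be uniform on them. With outcomes drawn from
`Ber(x k)` afresh, the distribution is calibrated and must be accepted. With outcomes fixed in
advance by a labelling `g`, some `κ ∈ K` rounds every point to its label, while the identity rounds
typically at least `n / 8` of them wrongly; the loss `kinkLoss`, which jumps at `1/2`, makes the
decision loss large, so the distribution must be rejected. If `g` is itself drawn from the product
of the `Ber(x k)`, a sample without repeated points has the same law in both cases
(`sum_labellings_le`), so telling them apart requires a collision, which has probability at most `m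
^ 2 / n`. This forces `m` to be of order `√n`. As the bound holds for every natural `d ≤ vcDim (thr
K)`, it also excludes finite samples when the dimension is infinite. -/

lemma Loss.IsProper.monotone_false {l : Loss} (hl : l.IsProper) :
    Monotone fun p => l p false := by
  intro p q hpq
  have h₁ := hl q p
  have h₂ := hl p q
  simp only [Loss.expected] at h₁ h₂
  have hp := p.2.1
  have hq := q.2.2
  rcases hpq.eq_or_lt with rfl | hlt
  · exact le_rfl
  have hlt' : (p : ℝ) < q := hlt
  by_contra! hcon
  have h0 : 0 ≤ (p : ℝ) * (l q true - l p true) := by nlinarith [p.2.2]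
  -- The two properness inequalities add up to `(q - p)` times this difference being nonpositive: `l
  -- p true - l p false` is a supergradient of the concave function `φ`, hence decreasing.
  have h1 : (l q true - l q false) - (l p true - l p false) ≤ 0 := by nlinarith
  nlinarith

lemma Loss.IsProper.antitone_true {l : Loss} (hl : l.IsProper) :
    Antitone fun p => l p true := by
  intro p q hpq
  have h₁ := hl q p
  have h₂ := hl p q
  simp only [Loss.expected] at h₁ h₂
  have hp := p.2.1
  have hq := q.2.2
  rcases hpq.eq_or_lt with rfl | hlt
  · exact le_rfl
  have hlt' : (p : ℝ) < q := hlt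
  by_contra! hcon
  have h1 : (l q true - l q false) - (l p true - l p false) ≤ 0 := by nlinarith
  nlinarith

/-- Chain `l p false ≤ l 1 false ≤ l 1 true + 1 ≤ l 0 true + 1 ≤ l 0 false + 2`. -/
lemma loss_false_sub_le {l : Loss} (hl : l ∈ properLosses) (p : unitInterval) :
    l p false - l 0 false ≤ 2 := by
  have h₁ := hl.1.monotone_false (show p ≤ 1 from unitInterval.le_one')
  have h₂ := hl.1.antitone_true (show (0 : unitInterval) ≤ 1 from zero_le_one)
  have h₃ := abs_le.1 (hl.2 0)
  have h₄ := abs_le.1 (hl.2 1)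
  simp only at h₁ h₂
  linarith [h₃.2, h₄.1]

lemma loss_true_sub_le {l : Loss} (hl : l ∈ properLosses) (p : unitInterval) :
    l 0 true - l p true ≤ 2 := by
  have h₁ := hl.1.antitone_true (show p ≤ 1 from unitInterval.le_one')
  have h₂ := hl.1.monotone_false (show (0 : unitInterval) ≤ 1 from zero_le_one)
  have h₃ := abs_le.1 (hl.2 0)
  have h₄ := abs_le.1 (hl.2 1)
  simp only at h₁ h₂
  linarith [h₃.2, h₄.1]

lemma abs_loss_sub_le {l : Loss} (hl : l ∈ properLosses) (p q : unitInterval) (y : Bool) :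
    |l p y - l q y| ≤ 2 := by
  cases y
  · have h₁ := loss_false_sub_le hl p
    have h₂ := loss_false_sub_le hl q
    have h₃ := hl.1.monotone_false (show 0 ≤ p from unitInterval.nonneg')
    have h₄ := hl.1.monotone_false (show 0 ≤ q from unitInterval.nonneg')
    simp only at h₃ h₄
    rw [abs_le]; constructor <;> linarith
  · have h₁ := loss_true_sub_le hl p
    have h₂ := loss_true_sub_le hl q
    have h₃ := hl.1.antitone_true (show 0 ≤ p from unitInterval.nonneg')
    have h₄ := hl.1.antitone_true (show 0 ≤ q from unitInterval.nonneg')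
    simp only at h₃ h₄
    rw [abs_le]; constructor <;> linarith

/-- The strongly proper loss whose sensitive part jumps at `1/2`. -/
noncomputable def kinkLoss (μ : ℝ) : Loss := fun p y =>
  -(1 - μ / 2) * (if (0 : ℝ) ≤ (p : ℝ) - 1 / 2 then 1 else -1) * (outcomeVal y - 1 / 2)
    + μ / 2 * (outcomeVal y - p) ^ 2

lemma kinkLoss_bayes (μ : ℝ) (p : unitInterval) :
    (kinkLoss μ).bayes p = -(1 - μ / 2) * |(p : ℝ) - 1 / 2| + μ / 2 * (p * (1 - p)) := by
  simp only [Loss.bayes, Loss.expected, kinkLoss, outcomeVal]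
  split_ifs with h <;> simp at *
  · rw [abs_of_nonneg (by linarith)]; ring
  · rw [abs_of_neg (by linarith)]; ring

/-- The quadratic part contributes `μ / 2 * p * (1 - p)` to `φ`, which is exactly `μ`-strongly
concave, and the jump contributes a concave multiple of `-|p - 1/2|`. The weight `1 - μ / 2` on the
jump keeps the difference between the two outcomes within `1`. -/
lemma kinkLoss_mem {μ : ℝ} (h0 : 0 < μ) (h1 : μ < 1) : kinkLoss μ ∈ stronglyProperLosses μ := by
  refine ⟨⟨fun p q => ?_, fun p => ?_⟩, ?_⟩
  · have h := kinkLoss_bayes μ q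
    rw [Loss.bayes] at h
    rw [h]
    have h2 : (kinkLoss μ).expected p q =
        -(1 - μ / 2) * (if (0 : ℝ) ≤ (p : ℝ) - 1 / 2 then 1 else -1) * (q - 1 / 2)
          + μ / 2 * (q * (1 - q) + (p - q) ^ 2) := by
      simp only [Loss.expected, kinkLoss, outcomeVal, if_true, Bool.false_eq_true, if_false]
      ring
    rw [h2]
    have h3 : (if (0 : ℝ) ≤ (p : ℝ) - 1 / 2 then (1 : ℝ) else -1) * (q - 1 / 2)
        ≤ |(q : ℝ) - 1 / 2| := by
      split_ifs
      · rw [one_mul]; exact le_abs_self _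
      · rw [neg_one_mul]; exact neg_le_abs _
    nlinarith [mul_nonneg (by linarith : (0 : ℝ) ≤ 1 - μ / 2) (sub_nonneg.2 h3),
      mul_nonneg h0.le (sq_nonneg ((p : ℝ) - q))]
  · have hp := p.2.1
    have hp' := p.2.2
    have e : kinkLoss μ p true - kinkLoss μ p false =
        -(1 - μ / 2) * (if (0 : ℝ) ≤ (p : ℝ) - 1 / 2 then 1 else -1) + μ / 2 * (1 - 2 * p) := by
      simp only [kinkLoss, outcomeVal, if_true, Bool.false_eq_true, if_false]
      ring
    rw [e, abs_le]
    split_ifs <;> constructor <;> nlinarith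
  · refine ⟨convex_Icc 0 1, ?_⟩
    intro x hx y hy a b ha hb hab
    have hz : a • x + b • y ∈ Set.Icc (0 : ℝ) 1 := convex_Icc 0 1 hx hy ha hb hab
    rw [Set.IccExtend_of_mem _ _ hx, Set.IccExtend_of_mem _ _ hy, Set.IccExtend_of_mem _ _ hz]
    simp only [kinkLoss_bayes, smul_eq_mul, Real.norm_eq_abs, sq_abs]
    have hb' : b = 1 - a := by linarith
    subst hb'
    have h3 : |a * x + (1 - a) * y - 1 / 2| ≤ a * |x - 1 / 2| + (1 - a) * |y - 1 / 2| := by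
      have := abs_add_le (a * (x - 1 / 2)) ((1 - a) * (y - 1 / 2))
      rw [abs_mul, abs_mul, abs_of_nonneg ha, abs_of_nonneg hb] at this
      rwa [show a * (x - 1 / 2) + (1 - a) * (y - 1 / 2) = a * x + (1 - a) * y - 1 / 2 by ring]
        at this
    nlinarith [mul_nonneg (by linarith : (0 : ℝ) ≤ 1 - μ / 2) (sub_nonneg.2 h3)]

/-! ### The calibration decision loss -/

lemma cdl_bddAbove {L : Set Loss} (hL : L ⊆ properLosses) (K : Set (unitInterval → unitInterval))
    (J : Measure Example) [IsProbabilityMeasure J] :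
    BddAbove {r | ∃ l ∈ L, ∃ κ ∈ K, r = ∫ z, (l z.1 z.2 - l (κ z.1) z.2) ∂J} := by
  refine ⟨2, ?_⟩
  rintro r ⟨l, hl, κ, -, rfl⟩
  -- No measurability is needed here: the integral of a non-integrable function is `0`.
  have h := norm_integral_le_of_norm_le_const (μ := J)
    (f := fun z : Example => l z.1 z.2 - l (κ z.1) z.2) (C := 2)
    (Eventually.of_forall fun z => abs_loss_sub_le (hL hl) _ _ _)
  rw [probReal_univ, mul_one] at h
  exact (le_abs_self _).trans h

lemma le_cdl {L : Set Loss} (hL : L ⊆ properLosses) {K : Set (unitInterval → unitInterval)}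
    (J : Measure Example) [IsProbabilityMeasure J] {l : Loss} (hl : l ∈ L)
    {κ : unitInterval → unitInterval} (hκ : κ ∈ K) :
    ∫ z, (l z.1 z.2 - l (κ z.1) z.2) ∂J ≤ cdl L K J :=
  le_csSup (cdl_bddAbove hL K J) ⟨l, hl, κ, hκ, rfl⟩

lemma stronglyProperLosses_subset (μ : ℝ) : stronglyProperLosses μ ⊆ properLosses :=
  fun _ h => h.1

/-! ### Thresholds of a valid class -/

lemma coe_clip_of_mem {t : ℝ} (h0 : 0 ≤ t) (h1 : t ≤ 1) : ((clip t : unitInterval) : ℝ) = t := by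
  simp [clip, Set.coe_projIcc, h0, h1]

lemma clip_coe (p : unitInterval) : clip (p : ℝ) = p := Set.projIcc_val _ p

lemma half_le_clip {t : ℝ} : (0 : ℝ) ≤ ((clip t : unitInterval) : ℝ) - 1 / 2 ↔ 1 / 2 ≤ t := by
  rw [clip, Set.coe_projIcc, sub_nonneg]
  constructor
  · intro h
    rcases le_max_iff.1 h with h | h
    · norm_num at h
    · exact h.trans (min_le_right _ _)
  · intro h
    exact le_max_of_le_right (le_min (by norm_num) h)

lemma signPlus_eq_one {t : ℝ} : signPlus t = 1 ↔ 0 ≤ t := by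
  unfold signPlus
  split_ifs with h <;> simp [h]

lemma IsValid.exists_thr {K : Set (unitInterval → unitInterval)} (hK : IsValid K)
    {κ : unitInterval → unitInterval} (hκ : κ ∈ K) (v : ℝ) :
    ∃ f ∈ thr K, ∀ p, f p = 1 ↔ v ≤ κ p := by
  have h := hK.translate_mem κ hκ 0 (1 / 2 - v)
  refine ⟨_, ⟨_, h, rfl⟩, fun p => ?_⟩
  rw [signPlus_eq_one, half_le_clip, add_zero, clip_coe]
  constructor <;> intro h <;> linarith

lemma IsValid.const_mem {K : Set (unitInterval → unitInterval)} (hK : IsValid K)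
    (c : unitInterval) : (fun _ => c) ∈ K := by
  -- Translating the input of the identity by `1` gives the constant `1`; the output is then lowered
  -- to `c`.
  have h := hK.translate_mem _ (hK.translate_mem _ hK.id_mem 1 0) 0 (c - 1)
  convert h using 1
  funext p
  have h1 : clip ((p : ℝ) + 1) = 1 := Set.projIcc_of_right_le _ (by linarith [p.2.1])
  simp only [add_zero, clip_coe, h1]
  rw [show ((1 : unitInterval) : ℝ) + ((c : ℝ) - 1) = c by simp, clip_coe]

/-! ### Measures with countable support -/

section CountableSupport

variable {α : Type*} [MeasurableSpace α] [MeasurableSingletonClass α] {ν : Measure α} {F : Set α}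

lemma nullMeasurableSet_of_countable_support (hF : F.Countable) (h : ν Fᶜ = 0) (s : Set α) :
    NullMeasurableSet s ν := by
  rw [← Set.inter_union_sdiff s F]
  refine (hF.mono Set.inter_subset_right).measurableSet.nullMeasurableSet.union
    (NullMeasurableSet.of_null (measure_mono_null (fun x hx => hx.2) h))

lemma aemeasurable_of_countable_support {β : Type*} [MeasurableSpace β] (hF : F.Countable)
    (h : ν Fᶜ = 0) (f : α → β) : AEMeasurable f ν := by
  have hr : ν.restrict F = ν := Measure.restrict_eq_self_of_ae_mem (by
    rw [ae_iff]; exact h)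
  rw [← hr]
  have : Countable F := hF
  refine aemeasurable_restrict_of_measurable_subtype hF.measurableSet ?_
  exact measurable_of_countable _

end CountableSupport

lemma fst_compl_image {J : Measure Example} {F : Set Example} (hF : F.Countable)
    (h : J Fᶜ = 0) : J.fst (Prod.fst '' F)ᶜ = 0 := by
  rw [Measure.fst_apply (hF.image _).measurableSet.compl]
  exact measure_mono_null (fun z hz hzF => hz ⟨z, hzF, rfl⟩) h

lemma isMeasurableClass_of_countable_support (K : Set (unitInterval → unitInterval))
    {J : Measure Example} [IsProbabilityMeasure J] {F : Set Example} (hF : F.Countable)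
    (h : J Fᶜ = 0) : IsMeasurableClass K J := by
  have h' := fst_compl_image hF h
  refine ⟨fun κ _ => aemeasurable_of_countable_support (hF.image _) h' κ, fun n σ => ?_⟩
  have hc : (Set.univ.pi fun _ : Fin n => Prod.fst '' F : Set (Fin n → unitInterval)).Countable :=
    Set.countable_univ_pi fun _ => hF.image _
  refine nullMeasurableSet_of_countable_support hc ?_ _
  change ∀ᵐ x ∂(Measure.pi fun _ : Fin n => J.fst), x ∈ Set.univ.pi fun _ => Prod.fst '' F
  have hall : ∀ i : Fin n, ∀ᵐ x ∂(Measure.pi fun _ : Fin n => J.fst), x i ∈ Prod.fst '' F :=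
    fun i => (Measure.quasiMeasurePreserving_eval (fun _ : Fin n => J.fst) i).ae h'
  filter_upwards [ae_all_iff.2 hall] with x hx i _ using hx i

/-! ### Comparison of the calibration decision losses of two distributions -/

lemma aemeasurable_comp_fst {P : Measure Example} {κ : unitInterval → unitInterval} (hκ : AEMeasurable κ P.fst) :
    AEMeasurable (fun z : Example => κ z.1) P :=
  hκ.comp_measurable measurable_fst

lemma nullMeasurableSet_label {P : Measure Example} {κ : unitInterval → unitInterval} (hκ : AEMeasurable κ P.fst)
    {U : Set unitInterval} (hU : MeasurableSet U) (b : Bool) :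
    NullMeasurableSet {z : Example | κ z.1 ∈ U ∧ z.2 = b} P :=
  ((aemeasurable_comp_fst hκ).nullMeasurableSet_preimage hU).inter
    (measurable_snd (measurableSet_singleton b)).nullMeasurableSet

section Comparison

variable {K : Set (unitInterval → unitInterval)} {P Q : Measure Example}
  [IsProbabilityMeasure P] [IsProbabilityMeasure Q] {Δ : ℝ}

/-- A nonempty upper set of `[0,1]` is a closed or an open ray from its infimum. A closed ray is a
threshold of an output translate of `κ`; an open ray is an increasing union of closed ones, and the
bound passes to the limit. -/
lemma abs_measureReal_upperSet_sub_le (hK : IsValid K)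
    (hΔ : ∀ f ∈ thr K, ∀ b, |P.real {z | f z.1 = 1 ∧ z.2 = b}
      - Q.real {z | f z.1 = 1 ∧ z.2 = b}| ≤ Δ)
    {κ : unitInterval → unitInterval} (hκ : κ ∈ K) (b : Bool) {U : Set unitInterval}
    (hU : IsUpperSet U) :
    |P.real {z | κ z.1 ∈ U ∧ z.2 = b} - Q.real {z | κ z.1 ∈ U ∧ z.2 = b}| ≤ Δ := by
  have key (v : ℝ) : |P.real {z | v ≤ κ z.1 ∧ z.2 = b} - Q.real {z | v ≤ κ z.1 ∧ z.2 = b}| ≤ Δ := by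
    obtain ⟨f, hf, hfv⟩ := hK.exists_thr hκ v
    simpa only [hfv] using hΔ f hf b
  rcases U.eq_empty_or_nonempty with rfl | hne
  · simpa using (abs_nonneg _).trans (key 0)
  by_cases hmem : sInf U ∈ U
  · have hUe (q : unitInterval) : q ∈ U ↔ ((sInf U : unitInterval) : ℝ) ≤ q :=
      ⟨fun h => sInf_le h, fun h => hU (show sInf U ≤ q from h) hmem⟩
    simpa only [hUe] using key _
  · have hUe (q : unitInterval) : q ∈ U ↔ ((sInf U : unitInterval) : ℝ) < q := by
      constructor
      · intro h
        exact lt_of_le_of_ne (sInf_le h : sInf U ≤ q)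
          (fun he => hmem (by rwa [Subtype.ext he]))
      · intro h
        obtain ⟨u, hu, hlt⟩ := sInf_lt_iff.1 (show sInf U < q from h)
        exact hU hlt.le hu
    have hlim (ν : Measure Example) [IsProbabilityMeasure ν] :
        Tendsto (fun k : ℕ => ν.real {z | ((sInf U : unitInterval) : ℝ) + 1 / ((k : ℝ) + 1) ≤ κ z.1
          ∧ z.2 = b}) atTop (𝓝 (ν.real {z | κ z.1 ∈ U ∧ z.2 = b})) := by
      refine (ENNReal.tendsto_toReal (measure_ne_top _ _)).comp ?_
      have hs : {z : Example | κ z.1 ∈ U ∧ z.2 = b} = ⋃ k : ℕ,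
          {z | ((sInf U : unitInterval) : ℝ) + 1 / ((k : ℝ) + 1) ≤ κ z.1 ∧ z.2 = b} := by
        ext z
        simp only [Set.mem_ofPred_eq, Set.mem_iUnion, hUe, exists_and_right]
        refine and_congr_left fun _ => ⟨fun h => ?_, fun ⟨k, hk⟩ => ?_⟩
        · obtain ⟨k, hk⟩ := exists_nat_one_div_lt (sub_pos.2 h)
          exact ⟨k, by linarith⟩
        · have : (0 : ℝ) < 1 / ((k : ℝ) + 1) := Nat.one_div_pos_of_nat
          linarith
      rw [hs]
      refine tendsto_measure_iUnion_atTop ?_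
      intro k k' hkk z hz
      exact ⟨(add_le_add_right (Nat.one_div_le_one_div hkk) _).trans hz.1, hz.2⟩
    exact le_of_tendsto ((hlim P).sub (hlim Q)).abs (Eventually.of_forall fun k => key _)

/-- Layer-cake formula: the superlevel sets of a monotone `g` are upper sets, and the level runs
over an interval of length `B`. -/
lemma abs_integral_monotone_sub_le (hK : IsValid K) (hP : ∀ κ ∈ K, AEMeasurable κ P.fst)
    (hQ : ∀ κ ∈ K, AEMeasurable κ Q.fst)
    (hΔ : ∀ f ∈ thr K, ∀ b, |P.real {z | f z.1 = 1 ∧ z.2 = b}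
      - Q.real {z | f z.1 = 1 ∧ z.2 = b}| ≤ Δ)
    {κ : unitInterval → unitInterval} (hκ : κ ∈ K) (b : Bool) {g : unitInterval → ℝ}
    (hg : Monotone g) (h0 : ∀ p, 0 ≤ g p) {B : ℝ} (hB0 : 0 ≤ B) (hB : ∀ p, g p ≤ B) :
    |∫ z, (if z.2 = b then g (κ z.1) else 0) ∂P - ∫ z, (if z.2 = b then g (κ z.1) else 0) ∂Q|
      ≤ Δ * B := by
  have hlc (ν : Measure Example) [IsProbabilityMeasure ν] (hR : ∀ κ ∈ K, AEMeasurable κ ν.fst) :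
      ∫ z, (if z.2 = b then g (κ z.1) else 0) ∂ν =
        ∫ t in Set.Ioc 0 B, ν.real {z | κ z.1 ∈ {q | t ≤ g q} ∧ z.2 = b} := by
    have hae : AEMeasurable (fun z : Example => if z.2 = b then g (κ z.1) else 0) ν := by
      have h1 : AEMeasurable (fun z : Example => g (κ z.1)) ν :=
        hg.measurable.comp_aemeasurable (aemeasurable_comp_fst (hR κ hκ))
      have := h1.indicator (measurable_snd (measurableSet_singleton b))
      refine this.congr (Eventually.of_forall fun z => ?_)
      simp [Set.indicator]
    have hbd : ∀ z : Example, 0 ≤ (if z.2 = b then g (κ z.1) else 0) ∧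
        (if z.2 = b then g (κ z.1) else 0) ≤ B := fun z => by
      split_ifs
      · exact ⟨h0 _, hB _⟩
      · exact ⟨le_rfl, hB0⟩
    have hint : Integrable (fun z : Example => if z.2 = b then g (κ z.1) else 0) ν :=
      Integrable.of_bound hae.aestronglyMeasurable B (Eventually.of_forall fun z => by
        rw [Real.norm_eq_abs, abs_of_nonneg (hbd z).1]; exact (hbd z).2)
    rw [hint.integral_eq_integral_Ioc_meas_le (Eventually.of_forall fun z => (hbd z).1)
      (Eventually.of_forall fun z => (hbd z).2)]
    refine setIntegral_congr_fun measurableSet_Ioc fun t ht => ?_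
    congr 1
    ext z
    simp only [Set.mem_ofPred_eq]
    split_ifs with h
    · simp [h]
    · simp [h, ht.1]
  have hint (ν : Measure Example) [IsProbabilityMeasure ν] : Integrable
      (fun t => ν.real {z | κ z.1 ∈ {q | t ≤ g q} ∧ z.2 = b}) (volume.restrict (Set.Ioc 0 B)) := by
    -- Measurability in the level `t` comes from monotonicity.
    have hanti : Antitone fun t => ν.real {z | κ z.1 ∈ {q | t ≤ g q} ∧ z.2 = b} :=
      fun s t hst => measureReal_mono fun z hz => ⟨hst.trans hz.1, hz.2⟩
    refine Integrable.of_bound hanti.measurable.aestronglyMeasurable 1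
      (Eventually.of_forall fun t => ?_)
    rw [Real.norm_eq_abs, abs_of_nonneg measureReal_nonneg]
    exact measureReal_le_one
  rw [hlc P hP, hlc Q hQ, ← integral_sub (hint P) (hint Q)]
  have h := norm_setIntegral_le_of_norm_le_const (μ := volume) (s := Set.Ioc 0 B) (C := Δ)
    (f := fun t => P.real {z | κ z.1 ∈ {q | t ≤ g q} ∧ z.2 = b}
      - Q.real {z | κ z.1 ∈ {q | t ≤ g q} ∧ z.2 = b}) (by simp)
    (fun t _ => abs_measureReal_upperSet_sub_le hK hΔ hκ b
      (fun p q hpq (hp : t ≤ g p) => hp.trans (hg hpq)))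
  simpa [hB0] using h

/-- The values at `0` cancel in the loss difference, which leaves four monotone terms with values in
`[0, 2]`, each costing `2 * Δ`. -/
lemma abs_integral_loss_sub_le (hK : IsValid K) (hP : ∀ κ ∈ K, AEMeasurable κ P.fst)
    (hQ : ∀ κ ∈ K, AEMeasurable κ Q.fst)
    (hΔ : ∀ f ∈ thr K, ∀ b, |P.real {z | f z.1 = 1 ∧ z.2 = b}
      - Q.real {z | f z.1 = 1 ∧ z.2 = b}| ≤ Δ)
    {κ : unitInterval → unitInterval} (hκ : κ ∈ K) {l : Loss} (hl : l ∈ properLosses) :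
    |∫ z, (l z.1 z.2 - l (κ z.1) z.2) ∂P - ∫ z, (l z.1 z.2 - l (κ z.1) z.2) ∂Q| ≤ 8 * Δ := by
  set g₁ : unitInterval → ℝ := fun q => l 0 true - l q true with hg₁
  set g₀ : unitInterval → ℝ := fun q => l q false - l 0 false with hg₀
  have m₁ : Monotone g₁ := fun p q h => sub_le_sub_left (hl.1.antitone_true h) _
  have m₀ : Monotone g₀ := fun p q h => sub_le_sub_right (hl.1.monotone_false h) _
  have n₁ : ∀ p, 0 ≤ g₁ p := fun p => sub_nonneg.2 (hl.1.antitone_true unitInterval.nonneg')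
  have n₀ : ∀ p, 0 ≤ g₀ p := fun p => sub_nonneg.2 (hl.1.monotone_false unitInterval.nonneg')
  have b₁ : ∀ p, g₁ p ≤ 2 := loss_true_sub_le hl
  have b₀ : ∀ p, g₀ p ≤ 2 := loss_false_sub_le hl
  have hi (ν : Measure Example) [IsProbabilityMeasure ν] {κ' : unitInterval → unitInterval}
      (hR : AEMeasurable κ' ν.fst) (b : Bool) {g : unitInterval → ℝ} (hg : Monotone g)
      (h0 : ∀ p, 0 ≤ g p) (h2 : ∀ p, g p ≤ 2) :
      Integrable (fun z : Example => if z.2 = b then g (κ' z.1) else 0) ν := by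
    have h1 : AEMeasurable (fun z : Example => g (κ' z.1)) ν :=
      hg.measurable.comp_aemeasurable (aemeasurable_comp_fst hR)
    have h1' := h1.indicator (measurable_snd (measurableSet_singleton b))
    refine Integrable.of_bound (h1'.congr (Eventually.of_forall fun z => ?_)).aestronglyMeasurable 2
      (Eventually.of_forall fun z => ?_)
    · simp [Set.indicator]
    · rw [Real.norm_eq_abs, abs_le]
      split_ifs
      · constructor <;> linarith [h0 (κ' z.1), h2 (κ' z.1)]
      · norm_num
  have hdec (ν : Measure Example) [IsProbabilityMeasure ν] (hR : ∀ κ ∈ K, AEMeasurable κ ν.fst) :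
      ∫ z, (l z.1 z.2 - l (κ z.1) z.2) ∂ν =
        (∫ z, (if z.2 = true then g₁ (κ z.1) else 0) ∂ν
          - ∫ z, (if z.2 = true then g₁ z.1 else 0) ∂ν)
        + (∫ z, (if z.2 = false then g₀ z.1 else 0) ∂ν
          - ∫ z, (if z.2 = false then g₀ (κ z.1) else 0) ∂ν) := by
    have hκR := hR κ hκ
    have hid := hR _ hK.id_mem
    rw [← integral_sub (hi ν hκR true m₁ n₁ b₁) (hi ν hid true m₁ n₁ b₁),
      ← integral_sub (hi ν hid false m₀ n₀ b₀) (hi ν hκR false m₀ n₀ b₀)]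
    refine Eq.trans ?_ (integral_add ((hi ν hκR true m₁ n₁ b₁).sub (hi ν hid true m₁ n₁ b₁))
      ((hi ν hid false m₀ n₀ b₀).sub (hi ν hκR false m₀ n₀ b₀)))
    refine integral_congr_ae (Eventually.of_forall fun z => ?_)
    rcases z with ⟨p, y⟩
    cases y <;> simp [hg₁, hg₀]
  rw [hdec P hP, hdec Q hQ]
  have t₁ := abs_le.1 (abs_integral_monotone_sub_le hK hP hQ hΔ hκ true m₁ n₁ zero_le_two b₁)
  have t₂ := abs_le.1 (abs_integral_monotone_sub_le hK hP hQ hΔ hK.id_mem true m₁ n₁ zero_le_two b₁)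
  have t₃ := abs_le.1 (abs_integral_monotone_sub_le hK hP hQ hΔ hκ false m₀ n₀ zero_le_two b₀)
  have t₄ := abs_le.1 (abs_integral_monotone_sub_le hK hP hQ hΔ hK.id_mem false m₀ n₀ zero_le_two b₀)
  rw [abs_le]
  constructor <;> linarith [t₁.1, t₁.2, t₂.1, t₂.2, t₃.1, t₃.2, t₄.1, t₄.2]

lemma cdl_le_cdl_add {L : Set Loss} (hL : L ⊆ properLosses) (hne : L.Nonempty) (hK : IsValid K)
    (hP : ∀ κ ∈ K, AEMeasurable κ P.fst) (hQ : ∀ κ ∈ K, AEMeasurable κ Q.fst)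
    (hΔ : ∀ f ∈ thr K, ∀ b, |P.real {z | f z.1 = 1 ∧ z.2 = b}
      - Q.real {z | f z.1 = 1 ∧ z.2 = b}| ≤ Δ) :
    cdl L K P ≤ cdl L K Q + 8 * Δ := by
  obtain ⟨l₀, hl₀⟩ := hne
  refine csSup_le ⟨_, l₀, hl₀, _, hK.id_mem, rfl⟩ ?_
  rintro r ⟨l, hl, κ, hκ, rfl⟩
  have h₁ := abs_le.1 (abs_integral_loss_sub_le hK hP hQ hΔ hκ (hL hl))
  have h₂ := le_cdl hL Q hl hκ
  linarith [h₁.2]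

end Comparison

/-! ### Concentration and counting -/

/-- Chebyshev's inequality: a variable with values in `[0, 1]` has variance at most `1 / 4`. -/
lemma measure_pi_abs_sum_sub_ge_le {ι : Type*} [Fintype ι] {Ω : ι → Type*}
    [∀ i, MeasurableSpace (Ω i)] {μ : (i : ι) → Measure (Ω i)} [∀ i, IsProbabilityMeasure (μ i)]
    {X : ∀ i, Ω i → ℝ} (hX : ∀ i, AEMeasurable (X i) (μ i)) (h01 : ∀ i ω, X i ω ∈ Set.Icc (0 : ℝ) 1)
    {c : ℝ} (hc : 0 < c) :
    Measure.pi μ {ω | c ≤ |∑ i, X i (ω i) - ∑ i, ∫ x, X i x ∂μ i|}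
      ≤ ENNReal.ofReal (Fintype.card ι / (4 * c ^ 2)) := by
  have hL (i : ι) : MemLp (X i) 2 (μ i) :=
    MemLp.of_bound (hX i).aestronglyMeasurable 1 (Eventually.of_forall fun ω => by
      rw [Real.norm_eq_abs, abs_of_nonneg (h01 i ω).1]; exact (h01 i ω).2)
  have hL' (i : ι) : MemLp (fun ω : ∀ i, Ω i => X i (ω i)) 2 (Measure.pi μ) :=
    (hL i).comp_measurePreserving (measurePreserving_eval μ i)
  have hS : MemLp (∑ i, fun ω : ∀ i, Ω i => X i (ω i)) 2 (Measure.pi μ) :=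
    memLp_finsetSum' _ fun i _ => hL' i
  have h := ProbabilityTheory.meas_ge_le_variance_div_sq hS hc
  have hE : ∫ ω, (∑ i, fun ω : ∀ i, Ω i => X i (ω i)) ω ∂(Measure.pi μ)
      = ∑ i, ∫ x, X i x ∂μ i := by
    simp only [Finset.sum_apply]
    rw [integral_finsetSum _ fun i _ => (hL' i).integrable one_le_two]
    refine Finset.sum_congr rfl fun i _ => ?_
    have := (measurePreserving_eval μ i).map_eq
    conv_rhs => rw [← this]
    rw [integral_map (measurable_pi_apply i).aemeasurable (by rw [this]; exact (hL i).1)]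
  rw [hE, ProbabilityTheory.variance_sum_pi hL] at h
  simp only [Finset.sum_apply] at h
  refine h.trans (ENNReal.ofReal_le_ofReal ?_)
  have hv : ∑ i, ProbabilityTheory.variance (X i) (μ i) ≤ ∑ _i : ι, (1 / 4 : ℝ) :=
    Finset.sum_le_sum fun i _ => by
      have := ProbabilityTheory.variance_le_sq_of_bounded (μ := μ i) (a := 0) (b := 1)
        (Eventually.of_forall (h01 i)) (hX i)
      norm_num at this ⊢
      exact this
  rw [Finset.sum_const, Finset.card_univ, nsmul_eq_mul] at hv
  rw [div_le_div_iff₀ (by positivity) (by positivity)]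
  nlinarith [sq_nonneg c]

/-- The Rademacher sum with signs `s`. -/
def signedSum {ι : Type*} [Fintype ι] (a : ι → ℝ) (s : ι → Bool) : ℝ :=
  ∑ j, if s j then a j else -a j

lemma sum_exp_signedSum_le {ι : Type*} [Fintype ι] [DecidableEq ι] {a : ι → ℝ}
    (ha : ∀ j, |a j| ≤ 1) (u : ℝ) :
    ∑ s : ι → Bool, Real.exp (u * signedSum a s)
      ≤ 2 ^ Fintype.card ι * Real.exp (Fintype.card ι * (u ^ 2 / 2)) := by
  have h1 (s : ι → Bool) : Real.exp (u * signedSum a s)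
      = ∏ j, Real.exp (u * if s j then a j else -a j) := by
    rw [signedSum, Finset.mul_sum, Real.exp_sum]
  simp only [h1]
  have h2 := Finset.prod_univ_sum (fun _ : ι => (Finset.univ : Finset Bool))
    (fun j b => Real.exp (u * if b then a j else -a j))
  rw [Fintype.piFinset_univ] at h2
  rw [← h2]
  have h3 : ∀ j ∈ (Finset.univ : Finset ι), (∑ b : Bool, Real.exp (u * if b then a j else -a j))
      ≤ 2 * Real.exp (u ^ 2 / 2) := by
    intro j _
    have := Real.cosh_le_exp_half_sq (u * a j)
    rw [Real.cosh_eq] at this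
    have h4 : (u * a j) ^ 2 / 2 ≤ u ^ 2 / 2 := by
      have : a j ^ 2 ≤ 1 := (sq_le_one_iff_abs_le_one _).2 (ha j)
      nlinarith [sq_nonneg u]
    have h5 := Real.exp_le_exp.2 h4
    simp only [Fintype.sum_bool, if_true, Bool.false_eq_true, if_false, mul_neg]
    linarith
  refine (Finset.prod_le_prod (fun j _ => by positivity) h3).trans_eq ?_
  rw [Finset.prod_const, Finset.card_univ, mul_pow, ← Real.exp_nat_mul]

lemma card_signedSum_ge_le {ι : Type*} [Fintype ι] [DecidableEq ι] [Nonempty ι] {a : ι → ℝ}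
    (ha : ∀ j, |a j| ≤ 1) {t : ℝ} (ht : 0 ≤ t) :
    ((Finset.univ.filter fun s : ι → Bool => t ≤ signedSum a s).card : ℝ)
      ≤ 2 ^ Fintype.card ι * Real.exp (-(t ^ 2 / (2 * Fintype.card ι))) := by
  have hm : (0 : ℝ) < Fintype.card ι := by exact_mod_cast Fintype.card_pos
  -- The minimiser of the Chernoff exponent `m * u ^ 2 / 2 - u * t`, with `m` the number of signs.
  set u : ℝ := t / Fintype.card ι with hu
  have hu0 : 0 ≤ u := by positivity
  have h1 : ((Finset.univ.filter fun s : ι → Bool => t ≤ signedSum a s).card : ℝ)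
      * Real.exp (u * t) ≤ ∑ s : ι → Bool, Real.exp (u * signedSum a s) := by
    rw [← nsmul_eq_mul, ← Finset.sum_const]
    calc _ ≤ ∑ s ∈ Finset.univ.filter fun s : ι → Bool => t ≤ signedSum a s,
          Real.exp (u * signedSum a s) := Finset.sum_le_sum fun s hs => by
            have := (Finset.mem_filter.1 hs).2
            exact Real.exp_le_exp.2 (mul_le_mul_of_nonneg_left this hu0)
      _ ≤ _ := Finset.sum_le_univ_sum_of_nonneg fun s => (Real.exp_pos _).le
  have h2 := h1.trans (sum_exp_signedSum_le ha u)
  rw [← le_div_iff₀ (Real.exp_pos _), mul_div_assoc, ← Real.exp_sub] at h2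
  refine h2.trans_eq ?_
  congr 2
  rw [hu]
  field_simp
  ring

lemma card_abs_signedSum_ge_le {ι : Type*} [Fintype ι] [DecidableEq ι] [Nonempty ι] {a : ι → ℝ}
    (ha : ∀ j, |a j| ≤ 1) {t : ℝ} (ht : 0 ≤ t) :
    ((Finset.univ.filter fun s : ι → Bool => t ≤ |signedSum a s|).card : ℝ)
      ≤ 2 * 2 ^ Fintype.card ι * Real.exp (-(t ^ 2 / (2 * Fintype.card ι))) := by
  have h1 := card_signedSum_ge_le ha ht
  have h2 := card_signedSum_ge_le (a := fun j => -a j) (fun j => by rw [abs_neg]; exact ha j) ht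
  have hneg (s : ι → Bool) : signedSum (fun j => -a j) s = -signedSum a s := by
    rw [signedSum, signedSum, ← Finset.sum_neg_distrib]
    exact Finset.sum_congr rfl fun j _ => by split_ifs <;> rfl
  simp only [hneg] at h2
  have h3 : (Finset.univ.filter fun s : ι → Bool => t ≤ |signedSum a s|) ⊆
      (Finset.univ.filter fun s : ι → Bool => t ≤ signedSum a s) ∪
      (Finset.univ.filter fun s : ι → Bool => t ≤ -signedSum a s) := by
    intro s hs
    simpa [le_abs] using hs
  have h4 : ((Finset.univ.filter fun s : ι → Bool => t ≤ |signedSum a s|).card : ℝ) ≤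
      (Finset.univ.filter fun s : ι → Bool => t ≤ signedSum a s).card +
      (Finset.univ.filter fun s : ι → Bool => t ≤ -signedSum a s).card := by
    exact_mod_cast (Finset.card_le_card h3).trans (Finset.card_union_le _ _)
  linarith

open Classical in
/-- The labellings of the points `x` by members of `C`. -/
noncomputable def patterns {ι : Type*} [Fintype ι] (C : Set (unitInterval → ℤˣ))
    (x : ι → unitInterval) : Finset (ι → ℤˣ) :=
  Finset.univ.filter fun σ => ∃ f ∈ C, ∀ i, f (x i) = σ i

lemma mem_patterns {ι : Type*} [Fintype ι] {C : Set (unitInterval → ℤˣ)}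
    {x : ι → unitInterval} {σ : ι → ℤˣ} : σ ∈ patterns C x ↔ ∃ f ∈ C, ∀ i, f (x i) = σ i := by
  simp [patterns]

lemma units_eq_of_eq_one_iff {a b : ℤˣ} (h : a = 1 ↔ b = 1) : a = b := by
  rcases Int.units_eq_one_or a with ha | ha <;> rcases Int.units_eq_one_or b with hb | hb <;>
    simp_all

/-- A form of the Sauer-Shelah lemma. -/
lemma pow_mul_card_patterns_le {ι : Type*} [Fintype ι] {C : Set (unitInterval → ℤˣ)} {d : ℕ}
    (hd : vcDim C ≤ d) (x : ι → unitInterval) {t : ℝ} (h0 : 0 ≤ t) (h1 : t ≤ 1) :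
    t ^ d * (patterns C x).card ≤ (1 + t) ^ Fintype.card ι := by
  classical
  let pos : (ι → ℤˣ) → Finset ι := fun σ => Finset.univ.filter fun i => σ i = 1
  have hpos (σ : ι → ℤˣ) (i : ι) : i ∈ pos σ ↔ σ i = 1 := by simp [pos]
  have hinj : Function.Injective pos := fun σ τ h => funext fun i =>
    units_eq_of_eq_one_iff (by rw [← hpos, ← hpos, h])
  set 𝒜 := (patterns C x).image pos with h𝒜
  have hcard : 𝒜.card = (patterns C x).card := Finset.card_image_of_injective _ hinj
  have hsh (T : Finset ι) (hT : 𝒜.Shatters T) : T.card ≤ d := by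
    have hget (T' : Finset ι) (hT' : T' ⊆ T) : ∃ f ∈ C, ∀ i ∈ T, f (x i) = 1 ↔ i ∈ T' := by
      obtain ⟨u, hu, hTu⟩ := hT hT'
      obtain ⟨σ, hσ, rfl⟩ := Finset.mem_image.1 hu
      obtain ⟨f, hf, hfσ⟩ := mem_patterns.1 hσ
      refine ⟨f, hf, fun i hi => ?_⟩
      rw [hfσ, ← hTu, Finset.mem_inter, hpos]
      simp [hi]
    -- Indices carrying the same point always receive the same label, so a shattered set of indices
    -- has distinct points.
    have hxinj : Set.InjOn x T := by
      intro i hi j hj hij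
      obtain ⟨f, -, hf⟩ := hget {i} (by simpa using hi)
      have h1 := (hf i hi).2 (Finset.mem_singleton_self i)
      rw [hij] at h1
      exact (Finset.mem_singleton.1 ((hf j hj).1 h1)).symm
    have hS : Shatters C (x '' T) := by
      intro g
      obtain ⟨f, hf, hfT⟩ := hget
        (T.filter fun i => ∃ h : x i ∈ x '' T, g ⟨x i, h⟩ = 1) (Finset.filter_subset _ _)
      refine ⟨f, hf, ?_⟩
      rintro ⟨_, i, hi, rfl⟩
      refine units_eq_of_eq_one_iff ((hfT i hi).trans ?_)
      rw [Finset.mem_filter]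
      exact ⟨fun ⟨_, _, h⟩ => h, fun h => ⟨hi, _, h⟩⟩
    have h := (le_iSup (fun S : {S : Set unitInterval // Shatters C S} => S.1.encard)
      ⟨_, hS⟩).trans hd
    simp only [hxinj.encard_image, Set.encard_coe_eq_coe_finsetCard] at h
    exact_mod_cast h
  -- Pajor's inequality bounds a family by the number of sets it shatters. Weighting these by `t ^
  -- T.card ≥ t ^ d` and summing over all index sets avoids partial binomial sums.
  calc t ^ d * (patterns C x).card ≤ t ^ d * 𝒜.shatterer.card := by
        rw [← hcard]
        exact mul_le_mul_of_nonneg_left (by exact_mod_cast 𝒜.card_le_card_shatterer) (by positivity)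
    _ = ∑ _T ∈ 𝒜.shatterer, t ^ d := by rw [Finset.sum_const, nsmul_eq_mul, mul_comm]
    _ ≤ ∑ T ∈ 𝒜.shatterer, t ^ T.card := Finset.sum_le_sum fun T hT =>
        pow_le_pow_of_le_one h0 h1 (hsh T (Finset.mem_shatterer.1 hT))
    _ ≤ ∑ T : Finset ι, t ^ T.card := Finset.sum_le_univ_sum_of_nonneg fun T => by positivity
    _ = (1 + t) ^ Fintype.card ι := by
        have := Finset.prod_one_add (f := fun _ : ι => t) Finset.univ
        simp only [Finset.prod_const, Finset.card_univ, Finset.powerset_univ] at this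
        exact this.symm

/-! ### Uniform convergence over the thresholds -/

lemma measurePreserving_comp_equiv {ι ι' α : Type*} [Fintype ι] [Fintype ι'] [MeasurableSpace α]
    (ν : Measure α) [SigmaFinite ν] (e : ι' ≃ ι) :
    MeasurePreserving (fun z : ι → α => z ∘ e) (Measure.pi fun _ => ν) (Measure.pi fun _ => ν) := by
  have hm : Measurable (fun z : ι → α => z ∘ e) :=
    measurable_pi_iff.2 fun i => measurable_pi_apply (e i)
  refine ⟨hm, (Measure.pi_eq fun s hs => ?_).symm⟩
  rw [Measure.map_apply hm (MeasurableSet.univ_pi hs)]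
  have : (fun z : ι → α => z ∘ e) ⁻¹' Set.univ.pi s = Set.univ.pi fun i => s (e.symm i) := by
    ext z
    simp only [Set.mem_preimage, Set.mem_univ_pi, Function.comp_apply]
    exact ⟨fun h i => by simpa using h (e.symm i), fun h i => by simpa using h (e i)⟩
  rw [this, Measure.pi_pi, Equiv.prod_comp e.symm fun i => ν (s i)]

/-- The indicator of the positive predictions with label `b`. -/
def hit (f : unitInterval → ℤˣ) (b : Bool) (z : Example) : ℝ :=
  if f z.1 = 1 ∧ z.2 = b then 1 else 0

lemma hit_mem (f : unitInterval → ℤˣ) (b : Bool) (z : Example) :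
    hit f b z ∈ Set.Icc (0 : ℝ) 1 := by
  unfold hit
  split_ifs <;> simp

lemma nullMeasurableSet_hit {K : Set (unitInterval → unitInterval)} {J : Measure Example}
    (hJ : IsMeasurableClass K J) {f : unitInterval → ℤˣ} (hf : f ∈ thr K) (b : Bool) :
    NullMeasurableSet {z : Example | f z.1 = 1 ∧ z.2 = b} J := by
  obtain ⟨κ, hκ, rfl⟩ := hf
  simp only [signPlus_eq_one]
  have hU : MeasurableSet {q : unitInterval | (0 : ℝ) ≤ (q : ℝ) - 1 / 2} :=
    measurableSet_le measurable_const (by fun_prop)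
  exact nullMeasurableSet_label (hJ.aemeasurable κ hκ) hU b

lemma hit_eq_indicator (f : unitInterval → ℤˣ) (b : Bool) :
    hit f b = Set.indicator {z : Example | f z.1 = 1 ∧ z.2 = b} (fun _ => (1 : ℝ)) := by
  funext z
  simp [hit, Set.indicator]

lemma aemeasurable_hit {K : Set (unitInterval → unitInterval)} {J : Measure Example}
    (hJ : IsMeasurableClass K J) {f : unitInterval → ℤˣ} (hf : f ∈ thr K) (b : Bool) :
    AEMeasurable (hit f b) J := by
  rw [hit_eq_indicator]
  exact aemeasurable_const.indicator₀ (nullMeasurableSet_hit hJ hf b)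

lemma integral_hit {K : Set (unitInterval → unitInterval)} {J : Measure Example}
    (hJ : IsMeasurableClass K J) {f : unitInterval → ℤˣ} (hf : f ∈ thr K) (b : Bool) :
    ∫ z, hit f b z ∂J = J.real {z : Example | f z.1 = 1 ∧ z.2 = b} := by
  rw [hit_eq_indicator, integral_indicator₀ (nullMeasurableSet_hit hJ hf b), setIntegral_const]
  simp

lemma IsMeasurableClass.nullMeasurableSet_pattern {K : Set (unitInterval → unitInterval)}
    {J : Measure Example} [IsProbabilityMeasure J] (hJ : IsMeasurableClass K J) {ι : Type*}
    [Fintype ι] (σ : ι → ℤˣ) :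
    NullMeasurableSet {z : ι → Example | ∃ f ∈ thr K, ∀ i, f (z i).1 = σ i}
      (Measure.pi fun _ => J) := by
  have e := (Fintype.equivFin ι).symm
  have h1 := measurePreserving_comp_equiv J.fst e
  have h2 := measurePreserving_pi (fun _ : ι => J) (fun _ : ι => J.fst) (f := fun _ => Prod.fst)
    (fun _ => ⟨measurable_fst, rfl⟩)
  have h3 := (hJ.nullMeasurableSet _ (σ ∘ e)).preimage (h1.comp h2).quasiMeasurePreserving
  convert h3 using 1
  ext z
  simp only [Set.mem_ofPred_eq, Set.mem_preimage, Function.comp_apply]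
  refine exists_congr fun f => and_congr_right fun _ => ⟨fun h i => h _, fun h i => ?_⟩
  simpa using h (e.symm i)

/-- The permutation of a double sample that exchanges the pairs with `s j = false`. -/
def swapPerm {ι : Type*} (s : ι → Bool) : Equiv.Perm (ι ⊕ ι) where
  toFun := Sum.elim (fun j => if s j then .inl j else .inr j)
    (fun j => if s j then .inr j else .inl j)
  invFun := Sum.elim (fun j => if s j then .inl j else .inr j)
    (fun j => if s j then .inr j else .inl j)
  left_inv := by rintro (j | j) <;> cases h : s j <;> simp [h]
  right_inv := by rintro (j | j) <;> cases h : s j <;> simp [h]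

/-- The double samples whose two halves disagree by at least `t` on some threshold. -/
def discrepant (C : Set (unitInterval → ℤˣ)) (ι : Type*) [Fintype ι] (t : ℝ) :
    Set (ι ⊕ ι → Example) :=
  {z | ∃ f ∈ C, ∃ b, t ≤ |∑ j, (hit f b (z (.inl j)) - hit f b (z (.inr j)))|}

/-- The event depends on the double sample only through a pattern of thresholds and a vector of
outcomes, so it is a finite union of events covered by the measurability of the class. -/
lemma nullMeasurableSet_discrepant {K : Set (unitInterval → unitInterval)}
    {J : Measure Example} [IsProbabilityMeasure J] (hJ : IsMeasurableClass K J) {ι : Type*}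
    [Fintype ι] (t : ℝ) :
    NullMeasurableSet (discrepant (thr K) ι t) (Measure.pi fun _ => J) := by
  let val (σ : ι ⊕ ι → ℤˣ) (y : ι ⊕ ι → Bool) (b : Bool) (i : ι ⊕ ι) : ℝ :=
    if σ i = 1 ∧ y i = b then 1 else 0
  have hB : discrepant (thr K) ι t = ⋃ (σ : ι ⊕ ι → ℤˣ) (y : ι ⊕ ι → Bool)
      (_ : ∃ b, t ≤ |∑ j, (val σ y b (.inl j) - val σ y b (.inr j))|),
      {z | ∃ f ∈ thr K, ∀ i, f (z i).1 = σ i} ∩ {z | ∀ i, (z i).2 = y i} := by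
    ext z
    simp only [Set.mem_iUnion, Set.mem_inter_iff, Set.mem_ofPred_eq, discrepant, hit, val]
    constructor
    · rintro ⟨f, hf, b, hb⟩
      exact ⟨fun i => f (z i).1, fun i => (z i).2, ⟨b, hb⟩, ⟨f, hf, fun i => rfl⟩, fun i => rfl⟩
    · rintro ⟨σ, y, ⟨b, hb⟩, ⟨f, hf, hσ⟩, hy⟩
      exact ⟨f, hf, b, by simpa only [hσ, hy] using hb⟩
  rw [hB]
  refine NullMeasurableSet.iUnion fun σ => NullMeasurableSet.iUnion fun y =>
    NullMeasurableSet.iUnion fun _ => (hJ.nullMeasurableSet_pattern σ).inter ?_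
  refine MeasurableSet.nullMeasurableSet ?_
  have : {z : ι ⊕ ι → Example | ∀ i, (z i).2 = y i} = ⋂ i, {z | (z i).2 = y i} := by
    ext z; simp
  rw [this]
  exact MeasurableSet.iInter fun i =>
    (measurable_snd.comp (measurable_pi_apply i)) (measurableSet_singleton (y i))

/-- With the double sample fixed, swapping pairs flips signs in the difference of the two halves. A
union bound over patterns and both labels meets two-sided Hoeffding: the factor `4` is two labels
times two tails. -/
lemma card_swap_discrepant_le {C : Set (unitInterval → ℤˣ)} {ι : Type*} [Fintype ι]
    [DecidableEq ι] [Nonempty ι] {t : ℝ} (ht : 0 ≤ t) (z : ι ⊕ ι → Example)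
    [DecidablePred fun s : ι → Bool => z ∘ swapPerm s ∈ discrepant C ι t] :
    ((Finset.univ.filter fun s : ι → Bool => z ∘ swapPerm s ∈ discrepant C ι t).card : ℝ)
      ≤ (patterns C fun i => (z i).1).card *
        (4 * 2 ^ Fintype.card ι * Real.exp (-(t ^ 2 / (2 * Fintype.card ι)))) := by
  classical
  let val (σ : ι ⊕ ι → ℤˣ) (b : Bool) (i : ι ⊕ ι) : ℝ :=
    if σ i = 1 ∧ (z i).2 = b then 1 else 0
  have hval (σ b i) : val σ b i ∈ Set.Icc (0 : ℝ) 1 := by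
    simp only [val]; split_ifs <;> simp
  let a (σ : ι ⊕ ι → ℤˣ) (b : Bool) (j : ι) : ℝ := val σ b (.inl j) - val σ b (.inr j)
  have ha (σ b j) : |a σ b j| ≤ 1 := by
    have h1 := hval σ b (.inl j)
    have h2 := hval σ b (.inr j)
    rw [abs_le]
    constructor <;> linarith [h1.1, h1.2, h2.1, h2.2]
  have hsub : (Finset.univ.filter fun s : ι → Bool => z ∘ swapPerm s ∈ discrepant C ι t) ⊆
      (patterns C fun i => (z i).1).biUnion fun σ => Finset.univ.biUnion fun b =>
        Finset.univ.filter fun s : ι → Bool => t ≤ |signedSum (a σ b) s| := by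
    intro s hs
    obtain ⟨f, hf, b, hb⟩ := (Finset.mem_filter.1 hs).2
    simp only [Finset.mem_biUnion, Finset.mem_filter, Finset.mem_univ, true_and]
    refine ⟨fun i => f (z i).1, mem_patterns.2 ⟨f, hf, fun i => rfl⟩, b, ?_⟩
    convert hb using 2
    refine Finset.sum_congr rfl fun j _ => ?_
    cases h : s j <;> simp [a, val, hit, swapPerm, h]
  have h1 : ((Finset.univ.filter fun s : ι → Bool => z ∘ swapPerm s ∈ discrepant C ι t).card : ℝ)
      ≤ ∑ σ ∈ patterns C fun i => (z i).1, ∑ b : Bool,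
        ((Finset.univ.filter fun s : ι → Bool => t ≤ |signedSum (a σ b) s|).card : ℝ) := by
    refine (Nat.cast_le.2 ((Finset.card_le_card hsub).trans Finset.card_biUnion_le)).trans ?_
    rw [Nat.cast_sum]
    refine Finset.sum_le_sum fun σ _ => (Nat.cast_le.2 Finset.card_biUnion_le).trans ?_
    rw [Nat.cast_sum]
  refine h1.trans ((Finset.sum_le_sum fun σ _ => Finset.sum_le_sum fun b _ =>
    card_abs_signedSum_ge_le (ha σ b) ht).trans_eq ?_)
  simp only [Finset.sum_const, nsmul_eq_mul, Finset.card_univ, Fintype.card_bool]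
  push_cast
  ring

/-- Symmetrization: each swap preserves the product measure, so the probability is an average over
the swaps, bounded pointwise by counting. The parameter `u` comes from the weighted Sauer-Shelah
bound, with `(1 + u) ^ (2 * m) ≤ exp (2 * m * u)`. -/
lemma measure_discrepant_le {K : Set (unitInterval → unitInterval)}
    {J : Measure Example} [IsProbabilityMeasure J] (hJ : IsMeasurableClass K J) {ι : Type*}
    [Fintype ι] [Nonempty ι] {d : ℕ} (hd : vcDim (thr K) ≤ d) {t u : ℝ} (ht : 0 ≤ t)
    (hu0 : 0 < u) (hu1 : u ≤ 1) :
    (Measure.pi fun _ => J) (discrepant (thr K) ι t) ≤ ENNReal.ofReal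
      (4 * (1 / u) ^ d * Real.exp (2 * Fintype.card ι * u - t ^ 2 / (2 * Fintype.card ι))) := by
  classical
  set B := discrepant (thr K) ι t with hB
  set ν : Measure (ι ⊕ ι → Example) := Measure.pi fun _ => J with hν
  have hBm : NullMeasurableSet B ν := nullMeasurableSet_discrepant hJ t
  set R : ℝ := 4 * (1 / u) ^ d *
    Real.exp (2 * Fintype.card ι * u - t ^ 2 / (2 * Fintype.card ι)) with hR
  have hpat (z : ι ⊕ ι → Example) :
      ((patterns (thr K) fun i => (z i).1).card : ℝ) ≤
        (1 / u) ^ d * Real.exp (2 * Fintype.card ι * u) := by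
    have h1 := pow_mul_card_patterns_le hd (fun i => (z i).1) hu0.le hu1
    have h2 : (1 + u) ^ Fintype.card (ι ⊕ ι) ≤ Real.exp (2 * Fintype.card ι * u) := by
      have h3 := pow_le_pow_left₀ (by linarith) (by linarith [Real.add_one_le_exp u] :
        1 + u ≤ Real.exp u) (Fintype.card (ι ⊕ ι))
      rw [← Real.exp_nat_mul, Fintype.card_sum] at h3
      rw [Fintype.card_sum]
      refine h3.trans_eq ?_
      push_cast
      ring_nf
    have h4 := h1.trans h2
    rw [mul_comm, ← le_div_iff₀ (by positivity)] at h4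
    rw [one_div, inv_pow]
    refine h4.trans_eq ?_
    rw [div_eq_mul_inv, mul_comm]
  have hcount (z : ι ⊕ ι → Example) :
      ((Finset.univ.filter fun s : ι → Bool => z ∘ swapPerm s ∈ B).card : ℝ)
        ≤ 2 ^ Fintype.card ι * R := by
    refine (card_swap_discrepant_le ht z).trans
      ((mul_le_mul_of_nonneg_right (hpat z) (by positivity)).trans_eq ?_)
    rw [hR, sub_eq_add_neg, Real.exp_add]
    ring
  have hmp (s : ι → Bool) : MeasurePreserving (fun z : ι ⊕ ι → Example => z ∘ swapPerm s) ν ν :=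
    measurePreserving_comp_equiv J (swapPerm s)
  have hnm (s : ι → Bool) : NullMeasurableSet ((fun z : ι ⊕ ι → Example => z ∘ swapPerm s) ⁻¹' B) ν :=
    hBm.preimage (hmp s).quasiMeasurePreserving
  have hind (s : ι → Bool) : AEMeasurable
      (((fun z : ι ⊕ ι → Example => z ∘ swapPerm s) ⁻¹' B).indicator (1 : (ι ⊕ ι → Example) → ENNReal)) ν :=
    aemeasurable_one.indicator₀ (hnm s)
  have hsum : (2 ^ Fintype.card ι : ENNReal) * ν B ≤ ENNReal.ofReal (2 ^ Fintype.card ι * R) := by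
    calc (2 ^ Fintype.card ι : ENNReal) * ν B
        = ∑ s : ι → Bool, ν ((fun z : ι ⊕ ι → Example => z ∘ swapPerm s) ⁻¹' B) := by
          simp only [(hmp _).measure_preimage hBm, Finset.sum_const, Finset.card_univ,
            Fintype.card_pi, Fintype.card_bool, Finset.prod_const, nsmul_eq_mul, Nat.cast_pow,
            Nat.cast_ofNat]
      _ = ∫⁻ z, ∑ s : ι → Bool,
            ((fun z : ι ⊕ ι → Example => z ∘ swapPerm s) ⁻¹' B).indicator 1 z ∂ν := by
          rw [lintegral_finsetSum' _ fun s _ => hind s]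
          exact Finset.sum_congr rfl fun s _ => (lintegral_indicator_one₀ (hnm s)).symm
      _ ≤ ∫⁻ _z, ENNReal.ofReal (2 ^ Fintype.card ι * R) ∂ν := lintegral_mono fun z => by
          have h := hcount z
          rw [← ENNReal.ofReal_le_ofReal_iff (by positivity), ENNReal.ofReal_natCast] at h
          refine le_trans (le_of_eq ?_) h
          rw [Finset.card_filter, Nat.cast_sum]
          refine Finset.sum_congr rfl fun s _ => ?_
          simp [Set.indicator_apply]
      _ = _ := by simp
  rw [ENNReal.ofReal_mul (by positivity)] at hsum
  have h2 : ENNReal.ofReal (2 ^ Fintype.card ι) = 2 ^ Fintype.card ι := by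
    rw [ENNReal.ofReal_pow (by norm_num)]; norm_num
  rw [h2] at hsum
  exact (ENNReal.mul_le_mul_iff_right (by positivity) (by finiteness)).1 hsum

/-- Ghost sample: if `S` is off by more than `m * Δ` on some `f`, an independent sample is within `m
* Δ / 2` of the mean of that same `f` with probability at least `1 / 2`, by Chebyshev and `2 ≤ m * Δ
^ 2`. -/
lemma half_le_measure_discrepant_section {K : Set (unitInterval → unitInterval)}
    {J : Measure Example} [IsProbabilityMeasure J] (hJ : IsMeasurableClass K J) {ι : Type*}
    [Fintype ι] [Nonempty ι] {Δ : ℝ} (hΔ : 0 < Δ) (hm : 2 ≤ Fintype.card ι * Δ ^ 2)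
    {S : ι → Example} {f : unitInterval → ℤˣ} (hf : f ∈ thr K) {b : Bool}
    (hS : Fintype.card ι * Δ < |∑ j, hit f b (S j)
      - Fintype.card ι * J.real {z | f z.1 = 1 ∧ z.2 = b}|) :
    1 / 2 ≤ (Measure.pi fun _ : ι => J)
      {S' | Sum.elim S S' ∈ discrepant (thr K) ι (Fintype.card ι * Δ / 2)} := by
  have hm0 : (0 : ℝ) < Fintype.card ι := by exact_mod_cast Fintype.card_pos
  set A := {S' : ι → Example | Fintype.card ι * Δ / 2 ≤
    |∑ j, hit f b (S' j) - ∑ _j : ι, ∫ z, hit f b z ∂J|} with hA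
  have hcheb : (Measure.pi fun _ : ι => J) A ≤ 1 / 2 := by
    refine (measure_pi_abs_sum_sub_ge_le (μ := fun _ : ι => J) (X := fun _ => hit f b)
      (fun _ => aemeasurable_hit hJ hf b) (fun _ z => hit_mem f b z)
      (by positivity : 0 < Fintype.card ι * Δ / 2)).trans ?_
    rw [show (1 / 2 : ENNReal) = ENNReal.ofReal (1 / 2) by
      rw [ENNReal.ofReal_div_of_pos two_pos]; simp]
    refine ENNReal.ofReal_le_ofReal ?_
    rw [div_le_div_iff₀ (by positivity) two_pos]
    nlinarith [mul_le_mul_of_nonneg_left hm hm0.le]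
  have hsub : Aᶜ ⊆ {S' | Sum.elim S S' ∈ discrepant (thr K) ι (Fintype.card ι * Δ / 2)} := by
    intro S' hS'
    refine ⟨f, hf, b, ?_⟩
    simp only [hA, Set.mem_compl_iff, Set.mem_ofPred_eq, not_le, integral_hit hJ hf b,
      Finset.sum_const, Finset.card_univ, nsmul_eq_mul] at hS'
    simp only [Sum.elim_inl, Sum.elim_inr, Finset.sum_sub_distrib]
    have := abs_sub_le (∑ j, hit f b (S j)) (∑ j, hit f b (S' j))
      (Fintype.card ι * J.real {z | f z.1 = 1 ∧ z.2 = b})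
    linarith
  refine le_trans ?_ (measure_mono hsub)
  have h1 : (1 : ENNReal) ≤ (Measure.pi fun _ : ι => J) A + (Measure.pi fun _ : ι => J) Aᶜ := by
    rw [← measure_univ (μ := Measure.pi fun _ : ι => J), ← Set.union_compl_self A]
    exact measure_union_le _ _
  have h2 := h1.trans (add_le_add_left hcheb _)
  have h3 := tsub_le_iff_left.2 h2
  rw [one_div, ENNReal.one_sub_inv_two] at h3
  rwa [one_div]

lemma exists_measurable_uniform {K : Set (unitInterval → unitInterval)}
    {J : Measure Example} [IsProbabilityMeasure J] (hJ : IsMeasurableClass K J) {ι : Type*}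
    [Fintype ι] [Nonempty ι] {d : ℕ} (hd : vcDim (thr K) ≤ d) {Δ : ℝ} (hΔ0 : 0 < Δ) (hΔ1 : Δ ≤ 1)
    (hm : 2 ≤ Fintype.card ι * Δ ^ 2)
    (hm' : 24 * (32 / Δ ^ 2) ^ d * Real.exp (-(Fintype.card ι * Δ ^ 2 / 16)) ≤ 1) :
    ∃ G : Set (ι → Example), MeasurableSet G ∧ 2 / 3 ≤ (Measure.pi fun _ : ι => J) G ∧
      ∀ S ∈ G, ∀ f ∈ thr K, ∀ b, |∑ j, hit f b (S j)
        - Fintype.card ι * J.real {z | f z.1 = 1 ∧ z.2 = b}| ≤ Fintype.card ι * Δ := by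
  have hm0 : (0 : ℝ) < Fintype.card ι := by exact_mod_cast Fintype.card_pos
  set ν : Measure (ι ⊕ ι → Example) := Measure.pi fun _ => J with hν
  set P : Measure (ι → Example) := Measure.pi fun _ => J with hP
  set B := discrepant (thr K) ι (Fintype.card ι * Δ / 2) with hB
  have hνB : ν B ≤ ENNReal.ofReal (1 / 6) := by
    -- This `u` makes the counting exponent `m * Δ ^ 2 / 16`, half of the Hoeffding exponent `m * Δ
    -- ^ 2 / 8`.
    refine (measure_discrepant_le hJ hd (u := Δ ^ 2 / 32) (by positivity) (by positivity)
      (by nlinarith)).trans (ENNReal.ofReal_le_ofReal ?_)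
    rw [one_div_div]
    have : 2 * Fintype.card ι * (Δ ^ 2 / 32) - (Fintype.card ι * Δ / 2) ^ 2 / (2 * Fintype.card ι)
        = -(Fintype.card ι * Δ ^ 2 / 16) := by
      field_simp
      ring
    rw [this]
    linarith
  have hmp := measurePreserving_sumPiEquivProdPi_symm (X := fun _ : ι ⊕ ι => Example) fun _ => J
  -- A measurable hull of the discrepant set has measurable sections, so the good set `G` is
  -- measurable; Markov's inequality then bounds its complement by `2 * (1 / 6)`.
  set D := (MeasurableEquiv.sumPiEquivProdPi fun _ : ι ⊕ ι => Example).symm ⁻¹' toMeasurable ν B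
    with hD
  have hDm : MeasurableSet D := hmp.measurable (measurableSet_toMeasurable _ _)
  have hDν : (P.prod P) D = ν B := by
    rw [hD, hmp.measure_preimage (measurableSet_toMeasurable _ _).nullMeasurableSet,
      measure_toMeasurable]
  have hsec : Measurable fun S => P (Prod.mk S ⁻¹' D) := measurable_measure_prodMk_left hDm
  refine ⟨{S | 1 / 2 ≤ P (Prod.mk S ⁻¹' D)}ᶜ,
    (measurableSet_le measurable_const hsec).compl, ?_, ?_⟩
  · have h1 := mul_meas_ge_le_lintegral (μ := P) hsec (1 / 2)
    rw [← Measure.prod_apply hDm, hDν] at h1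
    have h2 : P {S | 1 / 2 ≤ P (Prod.mk S ⁻¹' D)} ≤ ENNReal.ofReal (1 / 3) := by
      have h3 := mul_le_mul_right (h1.trans hνB) 2
      rw [← mul_assoc, show (2 : ENNReal) * (1 / 2) = 1 by
        rw [one_div, ENNReal.mul_inv_cancel (by simp) (by simp)], one_mul] at h3
      refine h3.trans_eq ?_
      rw [← ENNReal.ofReal_ofNat 2, ← ENNReal.ofReal_mul (by norm_num)]
      norm_num
    rw [prob_compl_eq_one_sub (measurableSet_le measurable_const hsec)]
    refine le_trans ?_ (tsub_le_tsub_left h2 1)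
    rw [← ENNReal.ofReal_one, ← ENNReal.ofReal_sub _ (by norm_num),
      ← ENNReal.ofReal_ofNat 2, ← ENNReal.ofReal_ofNat 3, ← ENNReal.ofReal_div_of_pos (by norm_num)]
    exact ENNReal.ofReal_le_ofReal (by norm_num)
  · intro S hS f hf b
    by_contra! hcon
    refine hS ?_
    refine (half_le_measure_discrepant_section hJ hΔ0 hm hf hcon).trans (measure_mono ?_)
    intro S' hS'
    have e : (MeasurableEquiv.sumPiEquivProdPi fun _ : ι ⊕ ι => Example).symm (S, S')
        = Sum.elim S S' := by
      funext i
      cases i <;> rfl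
    refine subset_toMeasurable ν B ?_
    rw [e]
    exact hS'

/-! ### The tester -/

/-- The empirical distribution of a sample. -/
noncomputable def empirical {m : ℕ} (S : Fin m → Example) : Measure Example :=
  (m : ENNReal)⁻¹ • ∑ j, Measure.dirac (S j)

lemma empirical_apply {m : ℕ} (S : Fin m → Example) (s : Set Example) :
    empirical S s = (m : ENNReal)⁻¹ * ∑ j, s.indicator 1 (S j) := by
  simp [empirical, Measure.dirac_apply]

lemma isProbabilityMeasure_empirical {m : ℕ} (hm : m ≠ 0) (S : Fin m → Example) :
    IsProbabilityMeasure (empirical S) := by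
  refine ⟨?_⟩
  rw [empirical_apply]
  simp only [Set.indicator_univ, Pi.one_apply, Finset.sum_const, Finset.card_univ, Fintype.card_fin,
    nsmul_eq_mul, mul_one]
  exact ENNReal.inv_mul_cancel (by exact_mod_cast hm) (by simp)

lemma empirical_compl_range {m : ℕ} (S : Fin m → Example) :
    empirical S (Set.range S)ᶜ = 0 := by
  simp [empirical_apply]

lemma empirical_real_hit {m : ℕ} (S : Fin m → Example) (f : unitInterval → ℤˣ) (b : Bool) :
    (empirical S).real {z | f z.1 = 1 ∧ z.2 = b} = (m : ℝ)⁻¹ * ∑ j, hit f b (S j) := by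
  rw [measureReal_def, empirical_apply, ENNReal.toReal_mul, ENNReal.toReal_inv,
    ENNReal.toReal_natCast, ENNReal.toReal_sum fun j _ => by simp [Set.indicator_apply]; split_ifs <;> simp]
  congr 1
  refine Finset.sum_congr rfl fun j _ => ?_
  simp only [hit, Set.indicator_apply, Set.mem_ofPred_eq, Pi.one_apply]
  split_ifs <;> simp

open Classical in
/-- The tester that compares the decision loss of the sample with a threshold. -/
noncomputable def plugInTester (L : Set Loss) (K : Set (unitInterval → unitInterval)) (θ : ℝ)
    (m : ℕ) : Algorithm m :=
  fun S => PMF.pure (if θ < cdl L K (empirical S) then Verdict.reject else Verdict.accept)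

lemma le_prob_of_forall_mem {m : ℕ} {A : Algorithm m} {J : Measure Example} {v : Verdict}
    {G : Set (Fin m → Example)} (hG : MeasurableSet G) (h : ∀ S ∈ G, A S = PMF.pure v) :
    (Measure.pi fun _ => J) G ≤ A.prob J v := by
  rw [← lintegral_indicator_one hG, Algorithm.prob]
  refine lintegral_mono fun S => ?_
  by_cases hS : S ∈ G
  · simp [hS, h S hS]
  · simp [hS]

/-- The empirical decision loss is within `8 * Δ` of the true one on a set of samples of probability
at least `2 / 3`, and the threshold lies in the middle of the gap of length `16 * Δ`. -/
lemma isTester_plugInTester {L : Set Loss} (hL : L ⊆ properLosses) (hne : L.Nonempty)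
    {K : Set (unitInterval → unitInterval)} (hK : IsValid K) {d : ℕ} (hd : vcDim (thr K) ≤ d)
    {α Δ : ℝ} (hΔ0 : 0 < Δ) (hΔ1 : Δ ≤ 1) {m : ℕ} (hm : 2 ≤ m * Δ ^ 2)
    (hm' : 24 * (32 / Δ ^ 2) ^ d * Real.exp (-(m * Δ ^ 2 / 16)) ≤ 1) :
    IsTester L K α (α - 16 * Δ) (plugInTester L K (α - 8 * Δ) m) := by
  intro J hJ hJK
  have hm0 : m ≠ 0 := by
    rintro rfl
    norm_num at hm
  have hmpos : (0 : ℝ) < m := by positivity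
  have : Nonempty (Fin m) := ⟨⟨0, Nat.pos_of_ne_zero hm0⟩⟩
  obtain ⟨G, hGm, hG, hGS⟩ := exists_measurable_uniform hJK (ι := Fin m) hd hΔ0 hΔ1
    (by simpa using hm) (by simpa using hm')
  have hclose (S) (hS : S ∈ G) : ∀ f ∈ thr K, ∀ b,
      |(empirical S).real {z | f z.1 = 1 ∧ z.2 = b} - J.real {z | f z.1 = 1 ∧ z.2 = b}| ≤ Δ := by
    intro f hf b
    have h := hGS S hS f hf b
    rw [Fintype.card_fin] at h
    rw [empirical_real_hit]
    have e : (m : ℝ)⁻¹ * ∑ j, hit f b (S j) - J.real {z | f z.1 = 1 ∧ z.2 = b} =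
        (m : ℝ)⁻¹ * (∑ j, hit f b (S j) - m * J.real {z | f z.1 = 1 ∧ z.2 = b}) := by
      field_simp
    rw [e, abs_mul, abs_of_pos (inv_pos.2 hmpos), inv_mul_le_iff₀ hmpos]
    exact h
  have hmeas (S : Fin m → Example) : ∀ κ ∈ K, AEMeasurable κ (empirical S).fst :=
    haveI := isProbabilityMeasure_empirical hm0 S
    (isMeasurableClass_of_countable_support K (Set.countable_range S)
      (empirical_compl_range S)).aemeasurable
  constructor
  · intro hα
    refine hG.trans (le_prob_of_forall_mem hGm fun S hS => ?_)
    have := isProbabilityMeasure_empirical hm0 S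
    have h := cdl_le_cdl_add (P := J) (Q := empirical S) hL hne hK hJK.aemeasurable (hmeas S)
      fun f hf b => by rw [abs_sub_comm]; exact hclose S hS f hf b
    rw [plugInTester, if_pos (by linarith)]
  · intro hα
    refine hG.trans (le_prob_of_forall_mem hGm fun S hS => ?_)
    have := isProbabilityMeasure_empirical hm0 S
    have h := cdl_le_cdl_add (P := empirical S) (Q := J) hL hne hK (hmeas S) hJK.aemeasurable
      (hclose S hS)
    rw [plugInTester, if_neg (by linarith)]

lemma IsValid.one_le_vcDim {K : Set (unitInterval → unitInterval)} (hK : IsValid K) :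
    1 ≤ vcDim (thr K) := by
  have hS : Shatters (thr K) {0} := by
    intro g
    rcases Int.units_eq_one_or (g ⟨0, rfl⟩) with h | h
    · refine ⟨_, ⟨_, hK.const_mem 1, rfl⟩, ?_⟩
      rintro ⟨p, rfl⟩
      rw [h, signPlus_eq_one]
      norm_num
    · refine ⟨_, ⟨_, hK.const_mem 0, rfl⟩, ?_⟩
      rintro ⟨p, rfl⟩
      rw [h, signPlus, if_neg (by norm_num)]
  have h : ({0} : Set unitInterval).encard ≤ vcDim (thr K) :=
    le_iSup (fun S : {S : Set unitInterval // Shatters (thr K) S} => S.1.encard) ⟨_, hS⟩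
  rwa [Set.encard_singleton] at h

/-- Everything is compared with powers of `2 / ε ≥ 2`. Here `73728 = 18 * 16 ^ 3`, and the `18 * d`
powers gained pay for `13 * d` from the pattern count and at most `5 * d` from the factor `24`. -/
lemma exp_sample_bound {d m : ℕ} (hd : 1 ≤ d) {ε : ℝ} (h0 : 0 < ε) (h1 : ε < 1)
    (hm : 73728 * (d * Real.log (2 / ε)) ≤ m * ε ^ 2) :
    24 * (32 / (ε / 16) ^ 2) ^ d * Real.exp (-(m * (ε / 16) ^ 2 / 16)) ≤ 1 := by
  have hx : (0 : ℝ) < 2 / ε := by positivity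
  have hx2 : 2 ≤ 2 / ε := by rw [le_div_iff₀ h0]; linarith
  have hexp : Real.exp (-(m * (ε / 16) ^ 2 / 16)) ≤ ((2 / ε) ^ (18 * d))⁻¹ := by
    rw [← Real.exp_log (pow_pos hx (18 * d)), ← Real.exp_neg, Real.exp_le_exp, Real.log_pow]
    push_cast
    nlinarith
  have hA : 32 / (ε / 16) ^ 2 ≤ (2 / ε) ^ 13 := by
    have e : 32 / (ε / 16) ^ 2 = 2 ^ 11 * (2 / ε) ^ 2 := by field_simp; norm_num
    rw [e, show (13 : ℕ) = 11 + 2 by norm_num, pow_add]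
    gcongr
  have hB : (24 : ℝ) ≤ (2 / ε) ^ (5 * d) := by
    calc (24 : ℝ) ≤ 2 ^ 5 := by norm_num
      _ ≤ (2 / ε) ^ 5 := by gcongr
      _ ≤ (2 / ε) ^ (5 * d) := pow_le_pow_right₀ (by linarith) (by omega)
  calc 24 * (32 / (ε / 16) ^ 2) ^ d * Real.exp (-(m * (ε / 16) ^ 2 / 16))
      ≤ (2 / ε) ^ (5 * d) * ((2 / ε) ^ 13) ^ d * ((2 / ε) ^ (18 * d))⁻¹ := by gcongr
    _ = 1 := by
      rw [← pow_mul, ← pow_add, ← add_mul]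
      exact mul_inv_cancel₀ (by positivity)

theorem exists_tester {K : Set (unitInterval → unitInterval)} (hK : IsValid K) {d : ℕ}
    (hd : vcDim (thr K) = d) (α : ℝ) {ε μ : ℝ} (hε0 : 0 < ε) (hε1 : ε < 1) (hμ0 : 0 < μ)
    (hμ1 : μ < 1) :
    ∃ m : ℕ, (m : ℝ) ≤ 100000 * (d * Real.log (2 / ε) / ε ^ 2) ∧
      ∃ A : Algorithm m, IsTester (stronglyProperLosses μ) K α (α - ε) A := by
  have hd1 : 1 ≤ d := by
    have h := hK.one_le_vcDim
    rw [hd] at h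
    exact_mod_cast h
  have hd1' : (1 : ℝ) ≤ d := by exact_mod_cast hd1
  have hlog : (1 / 2 : ℝ) ≤ Real.log (2 / ε) := by
    have h2 : Real.log 2 ≤ Real.log (2 / ε) :=
      Real.log_le_log two_pos (by rw [le_div_iff₀ hε0]; linarith)
    linarith [Real.log_two_gt_d9]
  have hε2 : ε ^ 2 ≤ 1 := by nlinarith
  set q : ℝ := d * Real.log (2 / ε) / ε ^ 2 with hq
  have hqε : q * ε ^ 2 = d * Real.log (2 / ε) := by
    rw [hq]; field_simp
  have hdl : (1 / 2 : ℝ) ≤ d * Real.log (2 / ε) := by nlinarith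
  have hq1 : 1 / 2 ≤ q := by
    rw [hq, le_div_iff₀ (by positivity)]
    nlinarith
  have hceil := Nat.le_ceil (73728 * q)
  -- Rounding up costs at most `1`, absorbed by the larger final constant since `q ≥ 1 / 2`; this
  -- uses `d ≥ 1`.
  have hceil' := Nat.ceil_lt_add_one (a := 73728 * q) (by linarith)
  have hm : 73728 * (d * Real.log (2 / ε)) ≤ (⌈73728 * q⌉₊ : ℝ) * ε ^ 2 := by
    rw [← hqε, ← mul_assoc]
    gcongr
  refine ⟨⌈73728 * q⌉₊, by linarith, plugInTester (stronglyProperLosses μ) K (α - 8 * (ε / 16)) _, ?_⟩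
  have h := isTester_plugInTester (L := stronglyProperLosses μ) (K := K) (α := α) (Δ := ε / 16)
    (m := ⌈73728 * q⌉₊)
    (stronglyProperLosses_subset μ) ⟨_, kinkLoss_mem hμ0 hμ1⟩ hK hd.le (by positivity)
    (by linarith) (by nlinarith) (exp_sample_bound hd1 hε0 hε1 hm)
  rwa [show α - 16 * (ε / 16) = α - ε by ring] at h

/-! ### Finitely supported measures -/

/-- The measure with mass `w a` at `e a`. -/
noncomputable def finiteMeasure {A α : Type*} [Fintype A] [MeasurableSpace α] (w : A → ENNReal)
    (e : A → α) : Measure α :=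
  ∑ a, w a • Measure.dirac (e a)

section FiniteMeasure

variable {A α : Type*} [Fintype A] [MeasurableSpace α]

lemma finiteMeasure_apply [MeasurableSingletonClass α] (w : A → ENNReal) (e : A → α) (s : Set α) :
    finiteMeasure w e s = ∑ a, w a * s.indicator 1 (e a) := by
  simp [finiteMeasure, Measure.dirac_apply]

lemma isProbabilityMeasure_finiteMeasure {w : A → ENNReal} (hw : ∑ a, w a = 1) (e : A → α) :
    IsProbabilityMeasure (finiteMeasure w e) :=
  ⟨by simp [finiteMeasure, hw]⟩

lemma finiteMeasure_compl_range [MeasurableSingletonClass α] (w : A → ENNReal) (e : A → α) :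
    finiteMeasure w e (Set.range e)ᶜ = 0 := by
  simp [finiteMeasure_apply]

lemma lintegral_finiteMeasure [MeasurableSingletonClass α] (w : A → ENNReal) (e : A → α)
    (F : α → ENNReal) : ∫⁻ z, F z ∂(finiteMeasure w e) = ∑ a, w a * F (e a) := by
  simp [finiteMeasure]

lemma integral_finiteMeasure [MeasurableSingletonClass α] {w : A → ENNReal}
    (hw : ∀ a, w a ≠ ⊤) (e : A → α) (F : α → ℝ) :
    ∫ z, F z ∂(finiteMeasure w e) = ∑ a, (w a).toReal * F (e a) := by
  rw [finiteMeasure, integral_finsetSum_measure fun a _ =>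
    (integrable_dirac (by simp)).smul_measure (hw a)]
  simp

/-- Makes every probability in the lower bound a finite sum, so an arbitrary algorithm raises no
measurability question. -/
lemma pi_finiteMeasure {ι : Type*} [Fintype ι] [DecidableEq ι] {w : ι → A → ENNReal}
    (hw : ∀ i, ∑ a, w i a = 1) (e : A → α) :
    Measure.pi (fun i => finiteMeasure (w i) e) =
      finiteMeasure (fun a : ι → A => ∏ i, w i (a i)) fun a i => e (a i) := by
  classical
  have := fun i => isProbabilityMeasure_finiteMeasure (hw i) e
  refine Measure.pi_eq fun s hs => ?_
  simp only [finiteMeasure, Measure.coe_finsetSum, Finset.sum_apply, Measure.smul_apply,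
    smul_eq_mul]
  rw [Finset.prod_univ_sum, Fintype.piFinset_univ]
  refine Finset.sum_congr rfl fun a _ => ?_
  rw [Measure.dirac_apply' _ (MeasurableSet.univ_pi hs), Finset.prod_mul_distrib]
  congr 1
  simp only [Measure.dirac_apply' _ (hs _), Set.indicator_apply, Set.mem_univ_pi, Pi.one_apply]
  rw [Finset.prod_ite_zero]
  simp

lemma prob_finiteMeasure {m : ℕ} (V : Algorithm m) {w : A → ENNReal} (hw : ∑ a, w a = 1)
    (e : A → Example) (v : Verdict) :
    V.prob (finiteMeasure w e) v = ∑ a : Fin m → A, (∏ j, w (a j)) * V (fun j => e (a j)) v := by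
  rw [Algorithm.prob, pi_finiteMeasure (fun _ => hw), lintegral_finiteMeasure]

end FiniteMeasure

lemma accept_add_reject (p : PMF Verdict) : p .accept + p .reject = 1 := by
  let e : Bool ≃ Verdict :=
    ⟨fun b => cond b .accept .reject, fun v => Verdict.rec true false v,
      fun b => by cases b <;> rfl, fun v => by cases v <;> rfl⟩
  have h := p.tsum_coe
  rw [← e.tsum_eq, tsum_bool] at h
  rw [add_comm]
  exact h

lemma ece_eq_zero {J : Measure Example} [IsProbabilityMeasure J]
    (h : ∀ T : Set unitInterval, MeasurableSet T →
      ∫ z in Prod.fst ⁻¹' T, (outcomeVal z.2 - (z.1 : ℝ)) ∂J = 0) : ece J = 0 := by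
  have hle : MeasurableSpace.comap (Prod.fst : Example → unitInterval) inferInstance ≤
      (inferInstance : MeasurableSpace Example) := measurable_fst.comap_le
  have hmeas : Measurable fun z : Example => outcomeVal z.2 - (z.1 : ℝ) :=
    ((measurable_of_countable outcomeVal).comp measurable_snd).sub
      (measurable_subtype_coe.comp measurable_fst)
  have hint : Integrable (fun z : Example => outcomeVal z.2 - (z.1 : ℝ)) J :=
    Integrable.of_bound hmeas.aestronglyMeasurable 1 (Eventually.of_forall fun z => by
      have h0 := z.1.2.1
      have h1 := z.1.2.2
      rw [Real.norm_eq_abs, abs_le, outcomeVal]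
      split_ifs <;> constructor <;> linarith)
  have h0 := ae_eq_condExp_of_forall_setIntegral_eq (μ := J) hle hint (g := fun _ => (0 : ℝ))
    (fun s _ _ => integrableOn_zero)
    (by
      rintro s ⟨T, hT, rfl⟩ _
      rw [h T hT]
      simp)
    aestronglyMeasurable_const
  rw [ece]
  refine (integral_congr_ae (g := fun _ => (0 : ℝ)) ?_).trans (by simp)
  filter_upwards [h0] with z hz
  rw [← hz, abs_zero]

/-! ### Calibrated and labelled distributions -/

/-- The probability of the outcome `b` under `Ber(p)`. -/
noncomputable def bern (p : unitInterval) (b : Bool) : ℝ := if b then p else 1 - p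

lemma bern_nonneg (p : unitInterval) (b : Bool) : 0 ≤ bern p b := by
  unfold bern
  split_ifs
  · exact p.2.1
  · linarith [p.2.2]

lemma sum_bern (p : unitInterval) : ∑ b, bern p b = 1 := by
  simp [bern]

section Hard

variable {n : ℕ} (x : Fin n → unitInterval)

/-- The calibrated distribution whose prediction is uniform among the points `x`. -/
noncomputable def calibrated : Measure Example :=
  finiteMeasure (fun a : Fin n × Bool => ENNReal.ofReal ((n : ℝ)⁻¹ * bern (x a.1) a.2))
    fun a => (x a.1, a.2)

/-- The distribution whose prediction is uniform among the points `x` and whose outcome is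
given by `g`. -/
noncomputable def labelled (g : Fin n → Bool) : Measure Example :=
  finiteMeasure (fun _ : Fin n => ENNReal.ofReal (n : ℝ)⁻¹) fun k => (x k, g k)

lemma sum_calibrated_weight (hn : n ≠ 0) :
    ∑ a : Fin n × Bool, ENNReal.ofReal ((n : ℝ)⁻¹ * bern (x a.1) a.2) = 1 := by
  have hn' : (n : ℝ) ≠ 0 := by exact_mod_cast hn
  rw [← ENNReal.ofReal_sum_of_nonneg fun a _ => mul_nonneg (by positivity) (bern_nonneg _ _),
    Fintype.sum_prod_type]
  simp [← Finset.mul_sum, sum_bern, hn', -Fintype.univ_bool]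

lemma sum_labelled_weight (hn : n ≠ 0) :
    ∑ _a : Fin n, ENNReal.ofReal (n : ℝ)⁻¹ = 1 := by
  have hn' : (n : ℝ) ≠ 0 := by exact_mod_cast hn
  rw [← ENNReal.ofReal_sum_of_nonneg fun a _ => by positivity]
  simp [hn']

lemma ece_calibrated (hn : n ≠ 0) : ece (calibrated x) = 0 := by
  classical
  have : IsProbabilityMeasure (calibrated x) :=
    isProbabilityMeasure_finiteMeasure (sum_calibrated_weight x hn) _
  refine ece_eq_zero fun T hT => ?_
  rw [← integral_indicator (measurable_fst hT), calibrated,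
    integral_finiteMeasure fun a => ENNReal.ofReal_ne_top]
  rw [Fintype.sum_prod_type]
  refine Finset.sum_eq_zero fun k _ => ?_
  have hr (b : Bool) : (ENNReal.ofReal ((n : ℝ)⁻¹ * bern (x k) b)).toReal =
      (n : ℝ)⁻¹ * bern (x k) b :=
    ENNReal.toReal_ofReal (mul_nonneg (by positivity) (bern_nonneg _ _))
  simp only [Set.indicator_apply, Set.mem_preimage, Fintype.sum_bool, hr]
  simp only [bern, outcomeVal, if_true, Bool.false_eq_true, if_false]
  split_ifs <;> ring

lemma accept_calibrated (hn : n ≠ 0) {L : Set Loss} {K : Set (unitInterval → unitInterval)}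
    {α : ℝ} {m : ℕ} {V : Algorithm m} (hV : IsAuditor L K α 0 V) :
    2 / 3 ≤ V.prob (calibrated x) .accept := by
  have h1 : IsProbabilityMeasure (calibrated x) :=
    isProbabilityMeasure_finiteMeasure (sum_calibrated_weight x hn) _
  refine (hV _ h1 (isMeasurableClass_of_countable_support K (Set.countable_range _)
    (finiteMeasure_compl_range _ _))).2 ?_
  rw [ece_calibrated x hn]
  norm_num

/-- The indicator that the outcome `b` contradicts the rounding of `p`. -/
noncomputable def mismatch (p : unitInterval) (b : Bool) : ℝ :=
  if ((0 : ℝ) ≤ (p : ℝ) - 1 / 2 ↔ b = true) then 0 else 1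

lemma mismatch_mem (p : unitInterval) (b : Bool) : mismatch p b ∈ Set.Icc (0 : ℝ) 1 := by
  unfold mismatch
  split_ifs <;> simp

/-- When `q` rounds to the outcome, replacing `p` by `q` gains the full jump on a mismatch; the
quadratic parts can lose at most `μ / 2`. -/
lemma le_kinkLoss_sub {μ : ℝ} (hμ : 0 < μ) {p q : unitInterval} {b : Bool}
    (hq : (0 : ℝ) ≤ (q : ℝ) - 1 / 2 ↔ b = true) :
    (1 - μ / 2) * mismatch p b - μ / 2 ≤ kinkLoss μ p b - kinkLoss μ q b := by
  have hp0 := p.2.1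
  have hp1 := p.2.2
  have hq0 := q.2.1
  have hq1 := q.2.2
  have hquad : -1 ≤ (outcomeVal b - p) ^ 2 - (outcomeVal b - q) ^ 2 := by
    unfold outcomeVal
    split_ifs <;> nlinarith
  have hkink : (1 - μ / 2) * mismatch p b =
      -(1 - μ / 2) * (if (0 : ℝ) ≤ (p : ℝ) - 1 / 2 then 1 else -1) * (outcomeVal b - 1 / 2)
      - -(1 - μ / 2) * (if (0 : ℝ) ≤ (q : ℝ) - 1 / 2 then 1 else -1) * (outcomeVal b - 1 / 2) := by
    unfold mismatch outcomeVal
    by_cases hp : (0 : ℝ) ≤ (p : ℝ) - 1 / 2 <;> cases b <;> simp only [hp, hq] <;> norm_num <;> ring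
  rw [hkink]
  unfold kinkLoss
  nlinarith

lemma le_cdl_labelled (hn : n ≠ 0) {K : Set (unitInterval → unitInterval)} {μ : ℝ} (hμ0 : 0 < μ)
    (hμ1 : μ < 1) {κ : unitInterval → unitInterval} (hκ : κ ∈ K) {g : Fin n → Bool}
    (hg : ∀ k, (0 : ℝ) ≤ (κ (x k) : ℝ) - 1 / 2 ↔ g k = true) :
    (1 - μ / 2) * ((n : ℝ)⁻¹ * ∑ k, mismatch (x k) (g k)) - μ / 2
      ≤ cdl (stronglyProperLosses μ) K (labelled x g) := by
  have hn' : (n : ℝ) ≠ 0 := by exact_mod_cast hn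
  have h1 : IsProbabilityMeasure (labelled x g) :=
    isProbabilityMeasure_finiteMeasure (sum_labelled_weight hn) _
  refine le_trans ?_ (le_cdl (stronglyProperLosses_subset μ) (labelled x g) (kinkLoss_mem hμ0 hμ1) hκ)
  rw [labelled, integral_finiteMeasure fun _ => ENNReal.ofReal_ne_top]
  simp only [ENNReal.toReal_ofReal (inv_nonneg.2 (Nat.cast_nonneg n))]
  calc (1 - μ / 2) * ((n : ℝ)⁻¹ * ∑ k, mismatch (x k) (g k)) - μ / 2
      = ∑ k : Fin n, (n : ℝ)⁻¹ * ((1 - μ / 2) * mismatch (x k) (g k) - μ / 2) := by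
        rw [← Finset.mul_sum, Finset.sum_sub_distrib, ← Finset.mul_sum]
        simp only [Finset.sum_const, Finset.card_univ, Fintype.card_fin, nsmul_eq_mul]
        field_simp
    _ ≤ _ := Finset.sum_le_sum fun k _ =>
        mul_le_mul_of_nonneg_left (le_kinkLoss_sub hμ0 (hg k)) (by positivity)

lemma reject_labelled (hn : n ≠ 0) {K : Set (unitInterval → unitInterval)} {μ : ℝ} (hμ0 : 0 < μ)
    (hμ1 : μ < 1) {m : ℕ} {V : Algorithm m}
    (hV : IsAuditor (stronglyProperLosses μ) K (1 / 8 - 2 * μ) 0 V)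
    {κ : unitInterval → unitInterval} (hκ : κ ∈ K) {g : Fin n → Bool}
    (hg : ∀ k, (0 : ℝ) ≤ (κ (x k) : ℝ) - 1 / 2 ↔ g k = true)
    (hmis : (n : ℝ) / 8 ≤ ∑ k, mismatch (x k) (g k)) :
    2 / 3 ≤ V.prob (labelled x g) .reject := by
  have h1 : IsProbabilityMeasure (labelled x g) :=
    isProbabilityMeasure_finiteMeasure (sum_labelled_weight hn) _
  refine (hV _ h1 (isMeasurableClass_of_countable_support K (Set.countable_range _)
    (finiteMeasure_compl_range _ _))).1 (lt_of_lt_of_le ?_ (le_cdl_labelled x hn hμ0 hμ1 hκ hg))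
  have hn' : (0 : ℝ) < n := by exact_mod_cast Nat.pos_of_ne_zero hn
  have h2 : 1 / 8 ≤ (n : ℝ)⁻¹ * ∑ k, mismatch (x k) (g k) := by
    rw [le_inv_mul_iff₀ hn']
    linarith
  -- A mismatch rate of `1 / 8` gives at least `1 / 8 - 9 * μ / 16`, above `1 / 8 - 2 * μ`.
  nlinarith

end Hard

/-- Without data the verdict has one law, which cannot accept and reject with probability `2 / 3`
each. The collision bound misses this case when `n` is small. -/
lemma not_isAuditor_zero {K : Set (unitInterval → unitInterval)} (hK : IsValid K) {μ : ℝ}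
    (hμ0 : 0 < μ) (hμ1 : μ < 1) (V : Algorithm 0) :
    ¬ IsAuditor (stronglyProperLosses μ) K (1 / 8 - 2 * μ) 0 V := by
  intro hV
  have h1 := accept_calibrated (fun _ : Fin 1 => 0) one_ne_zero hV
  have h2 := reject_labelled (fun _ : Fin 1 => 0) one_ne_zero hμ0 hμ1 hV (hK.const_mem 1)
    (g := fun _ => true) (fun k => by norm_num) (by norm_num [mismatch])
  rw [calibrated, prob_finiteMeasure V (sum_calibrated_weight (fun _ : Fin 1 => 0) one_ne_zero)] at h1
  rw [labelled, prob_finiteMeasure V (sum_labelled_weight one_ne_zero)] at h2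
  simp only [Finset.univ_unique, Finset.sum_singleton, Finset.univ_eq_empty, Finset.prod_empty,
    one_mul] at h1 h2
  have h3 := accept_add_reject (V fun j => j.elim0)
  have e1 (F : Fin 0 → Example) : F = fun j => j.elim0 := Subsingleton.elim _ _
  rw [e1 fun j => _] at h1 h2
  have h4 := add_le_add h1 h2
  rw [h3, ENNReal.div_add_div_same] at h4
  have h5 : (3 : ENNReal) < 2 + 2 := by norm_num
  rw [ENNReal.div_le_iff (by simp) (by simp), one_mul] at h4
  exact absurd h4 (not_le.2 h5)

/-! ### Random labellings and collisions -/

section Averaging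

variable {n m : ℕ}

lemma sum_prod_mul_prod_ite {q : Fin n → Bool → ℝ} (hq : ∀ k, ∑ b, q k b = 1) {i : Fin m → Fin n}
    (hi : Function.Injective i) (y : Fin m → Bool) :
    ∑ g : Fin n → Bool, (∏ k, q k (g k)) * ∏ j, (if g (i j) = y j then (1 : ℝ) else 0)
      = ∏ j, q (i j) (y j) := by
  let h (k : Fin n) (b : Bool) : ℝ :=
    q k b * ∏ j, if i j = k then (if b = y j then (1 : ℝ) else 0) else 1
  have h1 (g : Fin n → Bool) : (∏ k, q k (g k)) * ∏ j, (if g (i j) = y j then (1 : ℝ) else 0)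
      = ∏ k, h k (g k) := by
    simp only [h]
    rw [Finset.prod_mul_distrib, Finset.prod_comm]
    congr 1
    refine Finset.prod_congr rfl fun j _ => ?_
    rw [Finset.prod_ite_eq]
    simp
  simp only [h1]
  have h2 := Finset.prod_univ_sum (fun _ : Fin n => (Finset.univ : Finset Bool)) h
  rw [Fintype.piFinset_univ] at h2
  rw [← h2]
  symm
  refine Fintype.prod_of_injective i hi _ _ (fun k hk => ?_) fun j => ?_
  · rw [← hq k]
    refine Finset.sum_congr rfl fun b _ => ?_
    have : ∀ j, i j ≠ k := fun j hj => hk ⟨j, hj⟩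
    simp [h, this]
  · have (b : Bool) : h (i j) b = if b = y j then q (i j) b else 0 := by
      simp only [h, hi.eq_iff]
      rw [Finset.prod_ite_eq']
      simp
    simp only [this]
    rw [Finset.sum_ite_eq']
    simp

/-- Coordinates of a product distribution read at distinct indices are independent with their own
marginals. -/
lemma sum_prod_mul_comp {q : Fin n → Bool → ℝ} (hq : ∀ k, ∑ b, q k b = 1) {i : Fin m → Fin n}
    (hi : Function.Injective i) (r : (Fin m → Bool) → ℝ) :
    ∑ g : Fin n → Bool, (∏ k, q k (g k)) * r (fun j => g (i j))
      = ∑ y : Fin m → Bool, (∏ j, q (i j) (y j)) * r y := by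
  have h1 (g : Fin n → Bool) : r (fun j => g (i j)) =
      ∑ y : Fin m → Bool, (∏ j, (if g (i j) = y j then (1 : ℝ) else 0)) * r y := by
    have h2 (y : Fin m → Bool) : (∏ j, (if g (i j) = y j then (1 : ℝ) else 0)) =
        if (fun j => g (i j)) = y then 1 else 0 := by
      rw [Finset.prod_ite_zero]
      simp [funext_iff]
    simp [h2]
  simp only [h1, Finset.mul_sum]
  rw [Finset.sum_comm]
  refine Finset.sum_congr rfl fun y _ => ?_
  rw [← sum_prod_mul_prod_ite hq hi y, Finset.sum_mul]
  exact Finset.sum_congr rfl fun g _ => by ring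

/-- Birthday bound: there are at least `(n - m) ^ m` injections when `m ≤ n`, and Bernoulli's
inequality applies. -/
lemma card_not_injective_le (hn : n ≠ 0)
    [DecidablePred fun i : Fin m → Fin n => ¬ Function.Injective i] :
    ((Finset.univ.filter fun i : Fin m → Fin n => ¬ Function.Injective i).card : ℝ)
      ≤ (n : ℝ) ^ m * ((m : ℝ) ^ 2 / n) := by
  classical
  have hn' : (0 : ℝ) < n := by exact_mod_cast Nat.pos_of_ne_zero hn
  have hadd := Finset.card_filter_add_card_filter_not (s := (Finset.univ : Finset (Fin m → Fin n)))
    Function.Injective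
  have hinj : (Finset.univ.filter fun i : Fin m → Fin n => Function.Injective i).card
      = n.descFactorial m := by
    rw [← Fintype.card_subtype, Fintype.card_congr (Equiv.subtypeInjectiveEquivEmbedding _ _),
      Fintype.card_embedding_eq, Fintype.card_fin, Fintype.card_fin]
  rw [hinj, Finset.card_univ, Fintype.card_fun, Fintype.card_fin, Fintype.card_fin] at hadd
  have hadd' : (n.descFactorial m : ℝ) +
      (Finset.univ.filter fun i : Fin m → Fin n => ¬ Function.Injective i).card = (n : ℝ) ^ m := by
    exact_mod_cast hadd
  rcases le_or_gt ((n : ℝ)) ((m : ℝ) ^ 2) with h | h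
  · have h1 : 1 ≤ (m : ℝ) ^ 2 / n := (one_le_div hn').2 h
    have h2 : (0 : ℝ) ≤ n.descFactorial m := by positivity
    nlinarith [pow_pos hn' m]
  · have hmn : m ≤ n := by
      have h2 : m ^ 2 < n := by exact_mod_cast h
      nlinarith
    have h1 : (n : ℝ) ^ m * (1 - (m : ℝ) ^ 2 / n) ≤ n.descFactorial m := by
      have hmn' : (m : ℝ) ≤ n := by exact_mod_cast hmn
      have hdiv : (m : ℝ) / n ≤ 1 := (div_le_one hn').2 hmn'
      have hb := one_add_mul_le_pow (a := -((m : ℝ) / n)) (by linarith) m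
      calc (n : ℝ) ^ m * (1 - (m : ℝ) ^ 2 / n) ≤ (n : ℝ) ^ m * (1 + -((m : ℝ) / n)) ^ m := by
            refine mul_le_mul_of_nonneg_left (le_trans (le_of_eq ?_) hb) (by positivity)
            ring
        _ = ((n : ℝ) - m) ^ m := by
            rw [← mul_pow]
            congr 1
            field_simp
            ring
        _ ≤ ((n + 1 - m : ℕ) : ℝ) ^ m := by
            rw [Nat.cast_sub (by omega)]
            push_cast
            exact pow_le_pow_left₀ (by linarith) (by linarith) m
        _ ≤ n.descFactorial m := by exact_mod_cast Nat.pow_sub_le_descFactorial n m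
    linarith

/-- Index tuples without repetition contribute equally to both sides; on the others `r ≤ 1`, so the
excess is at most the collision probability. -/
lemma sum_labellings_le (hn : n ≠ 0) {q : Fin n → Bool → ℝ} (hq : ∀ k, ∑ b, q k b = 1)
    (hq0 : ∀ k b, 0 ≤ q k b) {r : (Fin m → Fin n × Bool) → ℝ} (h0 : ∀ a, 0 ≤ r a)
    (h1 : ∀ a, r a ≤ 1) :
    ∑ g : Fin n → Bool, (∏ k, q k (g k)) *
        ∑ i : Fin m → Fin n, (∏ _j : Fin m, (n : ℝ)⁻¹) * r (fun j => (i j, g (i j)))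
      ≤ (∑ a : Fin m → Fin n × Bool, (∏ j, (n : ℝ)⁻¹ * q (a j).1 (a j).2) * r a)
        + (m : ℝ) ^ 2 / n := by
  classical
  have hn' : (0 : ℝ) < n := by exact_mod_cast Nat.pos_of_ne_zero hn
  have hW : ∑ g : Fin n → Bool, ∏ k, q k (g k) = 1 := by
    have h2 := Finset.prod_univ_sum (fun _ : Fin n => (Finset.univ : Finset Bool)) q
    rw [Fintype.piFinset_univ] at h2
    rw [← h2]
    exact Finset.prod_eq_one fun k _ => hq k
  set c : ℝ := ∏ _j : Fin m, (n : ℝ)⁻¹ with hc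
  have hcn : c * (n : ℝ) ^ m = 1 := by
    rw [hc, Finset.prod_const, Finset.card_univ, Fintype.card_fin, ← mul_pow,
      inv_mul_cancel₀ hn'.ne', one_pow]
  have hc0 : 0 ≤ c := Finset.prod_nonneg fun j _ => by positivity
  have hE : ∑ a : Fin m → Fin n × Bool, (∏ j, (n : ℝ)⁻¹ * q (a j).1 (a j).2) * r a =
      ∑ i : Fin m → Fin n, c * ∑ y : Fin m → Bool,
        (∏ j, q (i j) (y j)) * r (fun j => (i j, y j)) := by
    rw [← (Equiv.arrowProdEquivProdArrow (Fin m) (fun _ => Fin n) (fun _ => Bool)).symm.sum_comp,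
      Fintype.sum_prod_type]
    refine Finset.sum_congr rfl fun i _ => ?_
    rw [Finset.mul_sum]
    refine Finset.sum_congr rfl fun y _ => ?_
    rw [Finset.prod_mul_distrib, ← mul_assoc]
    rfl
  have hL : ∑ g : Fin n → Bool, (∏ k, q k (g k)) *
      ∑ i : Fin m → Fin n, c * r (fun j => (i j, g (i j))) =
      ∑ i : Fin m → Fin n, c * ∑ g : Fin n → Bool,
        (∏ k, q k (g k)) * r (fun j => (i j, g (i j))) := by
    simp only [Finset.mul_sum]
    rw [Finset.sum_comm]
    exact Finset.sum_congr rfl fun i _ => Finset.sum_congr rfl fun g _ => by ring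
  rw [hE, hL]
  have hterm (i : Fin m → Fin n) : c * ∑ g : Fin n → Bool,
      (∏ k, q k (g k)) * r (fun j => (i j, g (i j))) ≤
      c * (∑ y : Fin m → Bool, (∏ j, q (i j) (y j)) * r (fun j => (i j, y j)))
        + c * (if ¬ Function.Injective i then 1 else 0) := by
    rw [← mul_add]
    refine mul_le_mul_of_nonneg_left ?_ hc0
    by_cases hi : Function.Injective i
    · rw [if_neg (not_not.2 hi), add_zero,
        sum_prod_mul_comp hq hi fun y => r fun j => (i j, y j)]
    · rw [if_pos hi]
      have h3 : 0 ≤ ∑ y : Fin m → Bool, (∏ j, q (i j) (y j)) * r (fun j => (i j, y j)) :=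
        Finset.sum_nonneg fun y _ => mul_nonneg (Finset.prod_nonneg fun j _ => hq0 _ _) (h0 _)
      have h4 : ∑ g : Fin n → Bool, (∏ k, q k (g k)) * r (fun j => (i j, g (i j))) ≤
          ∑ g : Fin n → Bool, ∏ k, q k (g k) := Finset.sum_le_sum fun g _ =>
            mul_le_of_le_one_right (Finset.prod_nonneg fun j _ => hq0 _ _) (h1 _)
      linarith
  refine (Finset.sum_le_sum fun i _ => hterm i).trans ?_
  rw [Finset.sum_add_distrib]
  refine add_le_add le_rfl ?_
  rw [← Finset.mul_sum, Finset.sum_boole]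
  calc _ ≤ c * ((n : ℝ) ^ m * ((m : ℝ) ^ 2 / n)) :=
        mul_le_mul_of_nonneg_left (card_not_injective_le hn) hc0
    _ = _ := by rw [← mul_assoc, hcn, one_mul]

end Averaging

/-! ### Lower bound for points shattered inside `[1/4, 3/4]` -/

lemma quarter_le_sum_bern_mul_mismatch {p : unitInterval} (h0 : (1 : ℝ) / 4 ≤ p)
    (h1 : (p : ℝ) ≤ 3 / 4) : 1 / 4 ≤ ∑ b, bern p b * mismatch p b := by
  rw [Fintype.sum_bool]
  unfold bern mismatch
  by_cases hp : (0 : ℝ) ≤ (p : ℝ) - 1 / 2 <;> simp only [hp] <;> norm_num <;> linarith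

-- A point `p` is mismatched with probability `min p (1 - p) ≥ 1 / 4`, so the expected count is at
-- least `n / 4`, and Chebyshev with deviation `n / 8` gives `16 / n`.
open Classical in
lemma sum_few_mismatch_le {n : ℕ} (hn : n ≠ 0) {x : Fin n → unitInterval}
    (hx : ∀ k, (1 : ℝ) / 4 ≤ x k ∧ (x k : ℝ) ≤ 3 / 4) :
    ∑ g ∈ Finset.univ.filter (fun g : Fin n → Bool => ¬ (n : ℝ) / 8 ≤ ∑ k, mismatch (x k) (g k)),
      ∏ k, bern (x k) (g k) ≤ 16 / n := by
  have hn' : (0 : ℝ) < n := by exact_mod_cast Nat.pos_of_ne_zero hn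
  have hw (k : Fin n) : ∑ b, ENNReal.ofReal (bern (x k) b) = 1 := by
    rw [← ENNReal.ofReal_sum_of_nonneg fun b _ => bern_nonneg _ _, sum_bern, ENNReal.ofReal_one]
  have hprob (k : Fin n) : IsProbabilityMeasure
      (finiteMeasure (fun b => ENNReal.ofReal (bern (x k) b)) (fun b : Bool => b)) :=
    isProbabilityMeasure_finiteMeasure (hw k) _
  have h := measure_pi_abs_sum_sub_ge_le
    (μ := fun k => finiteMeasure (fun b => ENNReal.ofReal (bern (x k) b)) (fun b : Bool => b))
    (X := fun k => mismatch (x k)) (fun k => (measurable_of_countable _).aemeasurable)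
    (fun k b => mismatch_mem _ _) (by positivity : (0 : ℝ) < n / 8)
  have hint (k : Fin n) : ∫ b, mismatch (x k) b
      ∂(finiteMeasure (fun b => ENNReal.ofReal (bern (x k) b)) (fun b : Bool => b)) =
      ∑ b, bern (x k) b * mismatch (x k) b := by
    rw [integral_finiteMeasure fun _ => ENNReal.ofReal_ne_top]
    simp only [ENNReal.toReal_ofReal (bern_nonneg _ _)]
  simp only [hint] at h
  rw [pi_finiteMeasure hw, finiteMeasure_apply] at h
  have hsumE : (n : ℝ) / 4 ≤ ∑ k, ∑ b, bern (x k) b * mismatch (x k) b := by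
    calc (n : ℝ) / 4 = ∑ _k : Fin n, (1 / 4 : ℝ) := by simp; ring
      _ ≤ _ := Finset.sum_le_sum fun k _ => quarter_le_sum_bern_mul_mismatch (hx k).1 (hx k).2
  rw [← ENNReal.ofReal_le_ofReal_iff (by positivity),
    ENNReal.ofReal_sum_of_nonneg fun g _ => Finset.prod_nonneg fun k _ => bern_nonneg _ _]
  refine le_trans ?_ (h.trans (ENNReal.ofReal_le_ofReal ?_))
  · rw [Finset.sum_filter]
    refine Finset.sum_le_sum fun g _ => ?_
    split_ifs with hg
    · exact zero_le
    · rw [Set.indicator_of_mem, Pi.one_apply, mul_one,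
        ENNReal.ofReal_prod_of_nonneg fun k _ => bern_nonneg _ _]
      rw [Set.mem_ofPred_eq, abs_sub_comm]
      refine le_trans ?_ (le_abs_self _)
      linarith
  · rw [Fintype.card_fin]
    refine le_of_eq ?_
    field_simp
    norm_num

/-- The rejection probability averaged over random labellings is at least `(1 - 16 / n) * (2 / 3)`,
and at most the calibrated one, `1 / 3`, plus `m ^ 2 / n`. -/
lemma auditor_sample_bound {K : Set (unitInterval → unitInterval)} {n : ℕ} (hn : n ≠ 0)
    {x : Fin n → unitInterval} (hx : ∀ k, (1 : ℝ) / 4 ≤ x k ∧ (x k : ℝ) ≤ 3 / 4)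
    (hK : ∀ g : Fin n → Bool, ∃ κ ∈ K, ∀ k, (0 : ℝ) ≤ (κ (x k) : ℝ) - 1 / 2 ↔ g k = true)
    {μ : ℝ} (hμ0 : 0 < μ) (hμ1 : μ < 1) {m : ℕ} {V : Algorithm m}
    (hV : IsAuditor (stronglyProperLosses μ) K (1 / 8 - 2 * μ) 0 V) :
    1 / 3 ≤ (m : ℝ) ^ 2 / n + 32 / (3 * n) := by
  classical
  have hn' : (0 : ℝ) < n := by exact_mod_cast Nat.pos_of_ne_zero hn
  set r : (Fin m → Fin n × Bool) → ℝ := fun a => (V (fun j => (x (a j).1, (a j).2)) .reject).toReal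
    with hr
  have hle (p : PMF Verdict) (v : Verdict) : (p v).toReal ≤ 1 := by
    have := ENNReal.toReal_mono ENNReal.one_ne_top (p.coe_le_one v)
    rwa [ENNReal.toReal_one] at this
  have hadd (p : PMF Verdict) : (p .accept).toReal + (p .reject).toReal = 1 := by
    rw [← ENNReal.toReal_add (p.apply_ne_top _) (p.apply_ne_top _), accept_add_reject,
      ENNReal.toReal_one]
  have hmain := sum_labellings_le (m := m) hn (q := fun k => bern (x k)) (fun k => sum_bern _)
    (fun k b => bern_nonneg _ _) (r := r) (fun a => ENNReal.toReal_nonneg) (fun a => hle _ _)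
  have hacc := accept_calibrated x hn hV
  rw [calibrated, prob_finiteMeasure V (sum_calibrated_weight x hn)] at hacc
  have hreal {A : Type} [Fintype A] (w : A → ℝ) (hw : ∀ a, 0 ≤ w a) (e : A → Example)
      (v : Verdict) (h : 2 / 3 ≤ ∑ a : Fin m → A, (∏ j, ENNReal.ofReal (w (a j))) *
        V (fun j => e (a j)) v) :
      2 / 3 ≤ ∑ a : Fin m → A, (∏ j, w (a j)) * (V (fun j => e (a j)) v).toReal := by
    have h1 := ENNReal.toReal_mono (by
      refine ENNReal.sum_ne_top.2 fun a _ => ENNReal.mul_ne_top ?_ (PMF.apply_ne_top _ _)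
      exact ENNReal.prod_ne_top fun j _ => ENNReal.ofReal_ne_top) h
    rw [ENNReal.toReal_sum fun a _ => ENNReal.mul_ne_top
      (ENNReal.prod_ne_top fun j _ => ENNReal.ofReal_ne_top) (PMF.apply_ne_top _ _)] at h1
    simp only [ENNReal.toReal_mul, ENNReal.toReal_prod, ENNReal.toReal_ofReal (hw _)] at h1
    norm_num at h1 ⊢
    exact h1
  have hacc' := hreal (fun a : Fin n × Bool => (n : ℝ)⁻¹ * bern (x a.1) a.2)
    (fun a => mul_nonneg (by positivity) (bern_nonneg _ _))
    (fun a => (x a.1, a.2)) _ hacc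
  have htot : ∑ a : Fin m → Fin n × Bool, ∏ j, (n : ℝ)⁻¹ * bern (x (a j).1) (a j).2 = 1 := by
    have h2 := Finset.prod_univ_sum (fun _ : Fin m => (Finset.univ : Finset (Fin n × Bool)))
      fun _ a => (n : ℝ)⁻¹ * bern (x a.1) a.2
    rw [Fintype.piFinset_univ] at h2
    rw [← h2]
    refine Finset.prod_eq_one fun j _ => ?_
    rw [Fintype.sum_prod_type]
    simp only [← Finset.mul_sum, sum_bern]
    simp [hn'.ne']
  have hrej : ∑ a : Fin m → Fin n × Bool, (∏ j, (n : ℝ)⁻¹ * bern (x (a j).1) (a j).2) * r a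
      ≤ 1 / 3 := by
    have h3 : ∑ a : Fin m → Fin n × Bool, (∏ j, (n : ℝ)⁻¹ * bern (x (a j).1) (a j).2) * r a
        + ∑ a : Fin m → Fin n × Bool, (∏ j, (n : ℝ)⁻¹ * bern (x (a j).1) (a j).2) *
          (V (fun j => (x (a j).1, (a j).2)) .accept).toReal = 1 := by
      rw [← Finset.sum_add_distrib, ← htot]
      refine Finset.sum_congr rfl fun a _ => ?_
      rw [← mul_add, add_comm, hadd, mul_one]
    linarith
  have hgood (g : Fin n → Bool) (hg : (n : ℝ) / 8 ≤ ∑ k, mismatch (x k) (g k)) :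
      2 / 3 ≤ ∑ i : Fin m → Fin n, (∏ _j : Fin m, (n : ℝ)⁻¹) * r (fun j => (i j, g (i j))) := by
    obtain ⟨κ, hκ, hκg⟩ := hK g
    have h := reject_labelled x hn hμ0 hμ1 hV hκ hκg hg
    rw [labelled, prob_finiteMeasure V (sum_labelled_weight hn)] at h
    exact hreal (fun _ : Fin n => (n : ℝ)⁻¹) (fun a => by positivity)
      (fun k => (x k, g k)) _ h
  have hW : ∑ g : Fin n → Bool, ∏ k, bern (x k) (g k) = 1 := by
    have h2 := Finset.prod_univ_sum (fun _ : Fin n => (Finset.univ : Finset Bool))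
      fun k => bern (x k)
    rw [Fintype.piFinset_univ] at h2
    rw [← h2]
    exact Finset.prod_eq_one fun k _ => sum_bern _
  have hbad := sum_few_mismatch_le hn hx
  have hsplit := Finset.sum_filter_add_sum_filter_not (Finset.univ : Finset (Fin n → Bool))
    (fun g => (n : ℝ) / 8 ≤ ∑ k, mismatch (x k) (g k)) fun g => ∏ k, bern (x k) (g k)
  rw [hW] at hsplit
  have hlow : (∑ g ∈ Finset.univ.filter
      (fun g : Fin n → Bool => (n : ℝ) / 8 ≤ ∑ k, mismatch (x k) (g k)),
      ∏ k, bern (x k) (g k)) * (2 / 3) ≤ ∑ g : Fin n → Bool, (∏ k, bern (x k) (g k)) *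
        ∑ i : Fin m → Fin n, (∏ _j : Fin m, (n : ℝ)⁻¹) * r (fun j => (i j, g (i j))) := by
    rw [Finset.sum_mul]
    refine (Finset.sum_le_sum fun g hg => mul_le_mul_of_nonneg_left
      (hgood g (Finset.mem_filter.1 hg).2) (Finset.prod_nonneg fun k _ => bern_nonneg _ _)).trans ?_
    refine Finset.sum_le_univ_sum_of_nonneg fun g => mul_nonneg
      (Finset.prod_nonneg fun k _ => bern_nonneg _ _) (Finset.sum_nonneg fun i _ =>
        mul_nonneg (Finset.prod_nonneg fun j _ => by positivity) ENNReal.toReal_nonneg)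
  have e : (32 : ℝ) / (3 * n) = 16 / n * (2 / 3) := by field_simp; norm_num
  rw [e]
  linarith

/-! ### Moving a shattered set to the middle of the interval -/

lemma exists_finset_shattered {C : Set (unitInterval → ℤˣ)} {d : ℕ} (hd : (d + 1 : ℕ) ≤ vcDim C) :
    ∃ T : Finset unitInterval, T.card = d + 1 ∧
      ∀ g : unitInterval → Bool, ∃ f ∈ C, ∀ p ∈ T, f p = 1 ↔ g p = true := by
  -- The strict inequality produces an actual shattered set, whether or not the supremum is
  -- attained.
  have hlt : (d : ℕ∞) < vcDim C := lt_of_lt_of_le (by exact_mod_cast Nat.lt_succ_self d) hd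
  obtain ⟨⟨S, hS⟩, hdS⟩ := lt_iSup_iff.1 hlt
  have hle : ((d + 1 : ℕ) : ℕ∞) ≤ S.encard := by
    push_cast
    exact Order.add_one_le_of_lt hdS
  obtain ⟨T, hTS, hT⟩ := Set.exists_subset_encard_eq hle
  have hfin : T.Finite := Set.finite_of_encard_eq_coe hT
  refine ⟨hfin.toFinset, ?_, fun g => ?_⟩
  · rw [hfin.encard_eq_coe_toFinset_card] at hT
    exact_mod_cast hT
  · obtain ⟨f, hf, hfS⟩ := hS fun p => if g p then 1 else -1
    refine ⟨f, hf, fun p hp => ?_⟩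
    rw [hfS ⟨p, hTS (hfin.mem_toFinset.1 hp)⟩]
    cases g p <;> simp

lemma IsValid.exists_shifted {K : Set (unitInterval → unitInterval)} (hK : IsValid K)
    {T : Finset unitInterval}
    (hT : ∀ g : unitInterval → Bool, ∃ f ∈ thr K, ∀ p ∈ T, f p = 1 ↔ g p = true) {s : ℝ}
    (hs : ∀ p ∈ T, (1 : ℝ) / 4 ≤ p + s ∧ (p : ℝ) + s ≤ 3 / 4) :
    ∃ x : Fin T.card → unitInterval, (∀ k, (1 : ℝ) / 4 ≤ x k ∧ (x k : ℝ) ≤ 3 / 4) ∧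
      ∀ g : Fin T.card → Bool, ∃ κ ∈ K, ∀ k, (0 : ℝ) ≤ (κ (x k) : ℝ) - 1 / 2 ↔ g k = true := by
  classical
  have hx (k : Fin T.card) : ((clip ((T.equivFin.symm k : unitInterval) + s) : unitInterval) : ℝ)
      = (T.equivFin.symm k : unitInterval) + s := by
    have h := hs _ (T.equivFin.symm k).2
    exact coe_clip_of_mem (by linarith [h.1]) (by linarith [h.2])
  refine ⟨fun k => clip ((T.equivFin.symm k : unitInterval) + s), fun k => ?_, fun g => ?_⟩
  · rw [hx]
    exact hs _ (T.equivFin.symm k).2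
  · obtain ⟨f, ⟨κ, hκ, rfl⟩, hf⟩ := hT fun p => if h : p ∈ T then g (T.equivFin ⟨p, h⟩) else false
    refine ⟨_, hK.translate_mem κ hκ (-s) 0, fun k => ?_⟩
    have h := hf _ (T.equivFin.symm k).2
    rw [signPlus_eq_one] at h
    simp only [hx, add_neg_cancel_right, clip_coe, add_zero]
    rw [h]
    simp

theorem auditor_lower_bound {K : Set (unitInterval → unitInterval)} (hK : IsValid K) {d : ℕ}
    (hd : (d : ℕ∞) ≤ vcDim (thr K)) {μ : ℝ} (hμ0 : 0 < μ) (hμ1 : μ < 1) {m : ℕ} {V : Algorithm m}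
    (hV : IsAuditor (stronglyProperLosses μ) K (1 / 8 - 2 * μ) 0 V) :
    1 / 12 * Real.sqrt d ≤ m := by
  rcases d with _ | d
  · simp
  have hm1 : (1 : ℝ) ≤ m := by
    rcases m with _ | m
    · exact absurd hV (not_isAuditor_zero hK hμ0 hμ1 V)
    · push_cast
      linarith [Nat.cast_nonneg (α := ℝ) m]
  obtain ⟨T, hTc, hT⟩ := exists_finset_shattered hd
  have key : ∃ (n : ℕ) (x : Fin n → unitInterval), d + 1 ≤ 2 * n ∧
      (∀ k, (1 : ℝ) / 4 ≤ x k ∧ (x k : ℝ) ≤ 3 / 4) ∧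
      ∀ g : Fin n → Bool, ∃ κ ∈ K, ∀ k, (0 : ℝ) ≤ (κ (x k) : ℝ) - 1 / 2 ↔ g k = true := by
    classical
    have hadd := Finset.card_filter_add_card_filter_not (s := T)
      fun p : unitInterval => (p : ℝ) ≤ 1 / 2
    have hsub (T' : Finset unitInterval) (h : T' ⊆ T) (g : unitInterval → Bool) :
        ∃ f ∈ thr K, ∀ p ∈ T', f p = 1 ↔ g p = true := by
      obtain ⟨f, hf, hfT⟩ := hT g
      exact ⟨f, hf, fun p hp => hfT p (h hp)⟩
    rcases le_total (T.filter fun p : unitInterval => ¬ (p : ℝ) ≤ 1 / 2).card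
        (T.filter fun p : unitInterval => (p : ℝ) ≤ 1 / 2).card with h | h
    · obtain ⟨x, hx, hxK⟩ := hK.exists_shifted (s := 1 / 4)
        (hsub (T.filter fun p : unitInterval => (p : ℝ) ≤ 1 / 2) (Finset.filter_subset _ _))
        (fun p hp => by
          have := (Finset.mem_filter.1 hp).2
          constructor <;> linarith [p.2.1])
      exact ⟨_, x, by omega, hx, hxK⟩
    · obtain ⟨x, hx, hxK⟩ := hK.exists_shifted (s := -(1 / 4))
        (hsub (T.filter fun p : unitInterval => ¬ (p : ℝ) ≤ 1 / 2) (Finset.filter_subset _ _))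
        (fun p hp => by
          have := (Finset.mem_filter.1 hp).2
          rw [not_le] at this
          constructor <;> linarith [p.2.2])
      exact ⟨_, x, by omega, hx, hxK⟩
  obtain ⟨n, x, hdn, hx, hxK⟩ := key
  have hn : n ≠ 0 := by omega
  have hn' : (0 : ℝ) < n := by exact_mod_cast Nat.pos_of_ne_zero hn
  have hdn' : ((d + 1 : ℕ) : ℝ) ≤ 2 * n := by exact_mod_cast hdn
  have hbound := auditor_sample_bound hn hx hxK hμ0 hμ1 hV
  have hsq : ((d + 1 : ℕ) : ℝ) ≤ (12 * m) ^ 2 := by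
    -- For `n ≤ 64`, `m ≥ 1` suffices as `128 ≤ 144`. For larger `n`, the bound reads `n ≤ 3 * m ^ 2
    -- + 32`, whence `n < 6 * m ^ 2`.
    rcases le_or_gt (n : ℝ) 64 with h | h
    · nlinarith
    · rw [show (32 : ℝ) / (3 * n) = (32 / 3) / n by field_simp, ← add_div, le_div_iff₀ hn'] at hbound
      nlinarith
  have := Real.sqrt_le_sqrt hsq
  rw [Real.sqrt_sq (by linarith)] at this
  linarith

end Calibration

theorem mainTheorem10 :
    (∃ C : ℝ, 0 < C ∧
      ∀ K : Set (unitInterval → unitInterval), IsValid K →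
      ∀ d : ℕ, vcDim (thr K) = (d : ℕ∞) →
      ∀ α ε μ : ℝ, α ∈ Set.Ioo (0 : ℝ) 1 → ε ∈ Set.Ioo (0 : ℝ) 1 → μ ∈ Set.Ioo (0 : ℝ) 1 →
        ∃ m : ℕ, (m : ℝ) ≤ C * (d * Real.log (2 / ε) / ε ^ 2) ∧
          ∃ A : Algorithm m, IsTester (stronglyProperLosses μ) K α (α - ε) A) ∧
    (∃ c : ℝ, 0 < c ∧
      ∀ K : Set (unitInterval → unitInterval), IsValid K →
      ∀ d : ℕ, (d : ℕ∞) ≤ vcDim (thr K) →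
      ∀ μ : ℝ, μ ∈ Set.Ioo (0 : ℝ) (1 / 16) →
      ∀ (m : ℕ) (A : Algorithm m),
        IsAuditor (stronglyProperLosses μ) K (1 / 8 - 2 * μ) 0 A → c * Real.sqrt d ≤ m) :=
  ⟨⟨100000, by norm_num, fun _ hK _ hd α _ _ _ hε hμ =>
      exists_tester hK hd α hε.1 hε.2 hμ.1 hμ.2⟩,
    ⟨1 / 12, by norm_num, fun _ hK _ hd _ hμ _ _ hA =>
      auditor_lower_bound hK hd hμ.1 (hμ.2.trans (by norm_num)) hA⟩⟩
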